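/- For an oriented link $L$ let $P_L(v,z)\in\mathbb Z[v^{\pm1},z^{\pm1}]$ be its HOMFLY polynomial, i.e. the isotopy invariant defined by $$v^{-1}P_{L_+}(v,z)-v\,P_{L_-}(v,z)=z\,P_{L_0}(v,z),\qquad P_{\text{unknot}}(v,z)=1,$$ where $L_+,L_-,L_0$ coincide except near one point, at which they have a positive crossing, a negative crossing and the oriented smoothing, respectively. Let $\#L$ be the number of components of $L$, write $$P_L(v,z)=(v^{-1}z)^{-\#L+1}\sum_{i\ge 0}p^i_L(v)\,z^{2i},$$ and call $p^0_L(v)\in\mathbb Z[v^{\pm1}]$ the zeroth coefficient polynomial of $L$. The degree of a Laurent polynomial in $v$ is its highest exponent of $v$. Lemma. Let $n\ge 1$, let $\beta$ be a positive $n$-braid, given as a product of $e$ standard generators $\sigma_i$ ($1\le i\le n-1$; no inverses), so that $\beta$ has $e$ crossings, and let $L(\beta)$ be its closure. Then $$\deg p^0_{L(\beta)}(v)\le n+e-\#L(\beta).$$ -/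

import Mathlib

namespace Homflypt

open scoped LaurentPolynomial

/-! ### Oriented link diagrams

An oriented link diagram in the plane is put in general position with respect to the height
function, with every crossing pointing upwards, and is recorded from bottom to top as the list of
its crossings, local minima and local maxima. At a generic height the diagram is a row of
vertical strands, recorded from left to right as a `List Bool` (`true` = oriented upwards,
`false` = oriented downwards). -/

/-- The elementary pieces of a diagram.
`crossing true` / `crossing false` is a positive / negative crossing of two upward strands;
`cup ε` is a local minimum and `cap ε` a local maximum, whose left branch has orientation `ε`
(and whose right branch has the opposite one). -/
inductive Piece where
  | crossing (sign : Bool)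
  | cup (ε : Bool)
  | cap (ε : Bool)

/-- The strands that enter an elementary piece from below. -/
def Piece.bottom : Piece → List Bool
  | .crossing _ => [true, true]
  | .cup _ => []
  | .cap ε => [ε, !ε]

/-- The strands that leave an elementary piece at the top. -/
def Piece.top : Piece → List Bool
  | .crossing _ => [true, true]
  | .cup ε => [ε, !ε]
  | .cap _ => []

/-- An elementary piece with exactly `pos` strands passing to the left of it. -/
structure Event where
  piece : Piece
  pos : ℕ

/-- A crossing of the strands number `p` and `p + 1` (counted from `0`). -/
abbrev X (sign : Bool) (p : ℕ) : Event := ⟨.crossing sign, p⟩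

/-- A local minimum creating the strands number `p` and `p + 1`. -/
abbrev cup (ε : Bool) (p : ℕ) : Event := ⟨.cup ε, p⟩

/-- A local maximum closing off the strands number `p` and `p + 1`. -/
abbrev cap (ε : Bool) (p : ℕ) : Event := ⟨.cap ε, p⟩

/-- `Runs s w t`: stacking the events `w` (the first one lowest) on the row of strands `s` is
possible and results in the row of strands `t`. -/
inductive Runs : List Bool → List Event → List Bool → Prop
  | nil (s : List Bool) : Runs s [] s
  | cons (a b : List Bool) (x : Piece) (w : List Event) (t : List Bool) :
      Runs (a ++ x.top ++ b) w t → Runs (a ++ x.bottom ++ b) (⟨x, a.length⟩ :: w) t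

/-- An oriented link diagram. -/
structure LinkDiagram where
  events : List Event
  closed : Runs [] events []

/-- The diagram of the unknot without crossings. -/
def unknot : LinkDiagram where
  events := [cup true 0, cap true 0]
  closed := by
    have h1 := Runs.cons [] [] (.cap true) [] [] (Runs.nil _)
    exact Runs.cons [] [] (.cup true) _ [] h1

/-! ### Isotopy -/

/-- Two pieces of diagram that differ by one elementary isotopy: the presentation of oriented
link diagrams modulo planar isotopy and the three Reidemeister moves. -/
inductive Move : List Event → List Event → Prop
  /-- two distant pieces exchange their heights -/
  | interchange (x y : Piece) (p q : ℕ) (h : p + x.bottom.length ≤ q) :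
      Move [⟨y, q⟩, ⟨x, p⟩] [⟨x, p⟩, ⟨y, q - x.bottom.length + x.top.length⟩]
  /-- a zigzag is straightened -/
  | zigzag_left (ε : Bool) (p : ℕ) : Move [cup (!ε) (p + 1), cap ε p] []
  | zigzag_right (ε : Bool) (p : ℕ) : Move [cup ε p, cap (!ε) (p + 1)] []
  /-- the two ways to rotate a crossing by a half turn agree -/
  | rotate (s : Bool) (p : ℕ) :
      Move [cup false p, cup false (p + 1), X s (p + 2), cap true (p + 3), cap true (p + 2)]
        [cup true (p + 2), cup true (p + 3), X s (p + 2), cap false (p + 1), cap false p]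
  /-- first Reidemeister move, with the kink on the right or on the left -/
  | reidemeister1_right (s : Bool) (p : ℕ) :
      Move [cup true (p + 1), X s p, cap true (p + 1)] []
  | reidemeister1_left (s : Bool) (p : ℕ) :
      Move [cup false p, X s (p + 1), cap false p] []
  /-- second Reidemeister move, for parallel strands -/
  | reidemeister2 (s : Bool) (p : ℕ) : Move [X s p, X (!s) p] []
  /-- second Reidemeister move, for antiparallel strands `↑↓` -/
  | reidemeister2_up_down (s : Bool) (p : ℕ) :
      Move [cup false p, X s (p + 1), cap true (p + 2),
        cup true (p + 2), X (!s) (p + 1), cap false p] []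
  /-- second Reidemeister move, for antiparallel strands `↓↑` -/
  | reidemeister2_down_up (s : Bool) (p : ℕ) :
      Move [cup true (p + 2), X s (p + 1), cap false p,
        cup false p, X (!s) (p + 1), cap true (p + 2)] []
  /-- third Reidemeister move -/
  | reidemeister3 (p : ℕ) :
      Move [X true p, X true (p + 1), X true p] [X true (p + 1), X true p, X true (p + 1)]

/-- Two link diagrams differ by one elementary isotopy somewhere inside. -/
def LinkDiagram.IsotopyStep (D D' : LinkDiagram) : Prop :=
  ∃ a x y b, Move x y ∧ D.events = a ++ x ++ b ∧ D'.events = a ++ y ++ b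

/-- Two link diagrams represent isotopic oriented links. -/
def LinkDiagram.Isotopic : LinkDiagram → LinkDiagram → Prop :=
  Relation.EqvGen LinkDiagram.IsotopyStep

/-- `Dp`, `Dm`, `D0` coincide except at one place, where they have a positive crossing, a negative
crossing, and two parallel strands, respectively. -/
def IsSkeinTriple (Dp Dm D0 : LinkDiagram) : Prop :=
  ∃ a p b, Dp.events = a ++ [X true p] ++ b ∧ Dm.events = a ++ [X false p] ++ b ∧
    D0.events = a ++ b

/-! ### The number of components -/

/-- The events of a diagram are read from bottom to top; the two strands starting at the `k`-th
local minimum are labelled `k`, a label follows its strand upwards, `s` is the current row of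
labels and `k` the number of local minima met so far. The result is the list of the pairs of
labels that meet at a local maximum. -/
def arcJoins : List Event → List ℕ → ℕ → List (ℕ × ℕ)
  | [], _, _ => []
  | ⟨.crossing _, p⟩ :: w, s, k =>
      arcJoins w (s.take p ++ ((s.drop p).take 2).reverse ++ s.drop (p + 2)) k
  | ⟨.cup _, p⟩ :: w, s, k => arcJoins w (s.take p ++ [k, k] ++ s.drop p) (k + 1)
  | ⟨.cap _, p⟩ :: w, s, k =>
      (s.getD p 0, s.getD (p + 1) 0) :: arcJoins w (s.take p ++ s.drop (p + 2)) k

/-- The number of local minima of a diagram. -/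
def LinkDiagram.numMinima (D : LinkDiagram) : ℕ :=
  D.events.countP fun e => match e.piece with
    | .cup _ => true
    | _ => false

/-- The number `#L` of components of a link: every component has a local minimum, and two local
minima lie on the same component iff their arcs are connected through local maxima. -/
noncomputable def LinkDiagram.numComponents (D : LinkDiagram) : ℕ :=
  Nat.card (Quot fun i j : Fin D.numMinima => ((i : ℕ), (j : ℕ)) ∈ arcJoins D.events [] 0)

/-! ### The HOMFLY polynomial -/

/-- Laurent polynomials in two variables: the inner variable is `v`, the outer one is `z`. -/
abbrev Laurent₂ : Type := ℤ[T;T⁻¹][T;T⁻¹]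

/-- The monomial `v ^ k`. -/
noncomputable def vPow (k : ℤ) : Laurent₂ := LaurentPolynomial.C (LaurentPolynomial.T k)

/-- The variable `z`. -/
noncomputable def zVar : Laurent₂ := LaurentPolynomial.T 1

/-- The relations imposed on formal linear combinations of link diagrams: isotopic links are
identified, and `v⁻¹ L₊ - v L₋ = z L₀` for every skein triple. -/
noncomputable def skeinRelations : Submodule Laurent₂ (LinkDiagram →₀ Laurent₂) :=
  Submodule.span Laurent₂
    ({x | ∃ D D' : LinkDiagram, D.Isotopic D' ∧
        x = Finsupp.single D 1 - Finsupp.single D' 1} ∪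
      {x | ∃ Dp Dm D0 : LinkDiagram, IsSkeinTriple Dp Dm D0 ∧
        x = Finsupp.single Dp (vPow (-1)) - Finsupp.single Dm (vPow 1) -
          Finsupp.single D0 zVar})

/-- `P` is the value at `D` that is forced by isotopy invariance, the skein relation and the value
`1` at the unknot: modulo the relations, `D` equals `P` times the unknot. -/
def IsHomfly (D : LinkDiagram) (P : Laurent₂) : Prop :=
  Finsupp.single D 1 - Finsupp.single unknot P ∈ skeinRelations

/-- The HOMFLY polynomial `P_L(v, z)` of (the link represented by) a nonempty diagram: the Laurent
polynomial determined by the skein relation and the value at the unknot. -/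
noncomputable def homfly (D : LinkDiagram) : Laurent₂ :=
  Classical.epsilon (IsHomfly D)

/-- The `i`-th coefficient polynomial `p^i_L(v)`, defined by
`P_L(v, z) = (v⁻¹ z) ^ (1 - #L) * ∑ i, p^i_L(v) z ^ (2 i)`: the coefficient of
`z ^ (2 i + 1 - #L)` in `P_L`, multiplied by `v ^ (1 - #L)`. -/
noncomputable def coeffPoly (i : ℕ) (D : LinkDiagram) : ℤ[T;T⁻¹] :=
  LaurentPolynomial.T (1 - (D.numComponents : ℤ)) *
    (homfly D).coeff (2 * (i : ℤ) + 1 - (D.numComponents : ℤ))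

/-! ### Braids and their closures -/

/-- A word in the standard generators of the braid group on `n` strands and their inverses:
`(i, true)` is the generator crossing the strands number `i` and `i + 1` (counted from `0`)
positively, `(i, false)` is its inverse. -/
abbrev BraidWord (n : ℕ) : Type := List (Fin (n - 1) × Bool)

/-- A braid word is positive if it contains no inverse of a generator. -/
def BraidWord.IsPositive {n : ℕ} (β : BraidWord n) : Prop := ∀ x ∈ β, x.2 = true

/-- The events of the closure of a braid: `n` nested local minima, the braid on the `n` upward
strands on the left, and `n` nested local maxima. -/
def closureEvents (n : ℕ) (β : BraidWord n) : List Event :=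
  (List.range n).map (cup true) ++ β.map (fun x => X x.2 x.1) ++
    (List.range n).reverse.map (cap true)

theorem Runs.append {s t u : List Bool} {w w' : List Event} (h : Runs s w t) (h' : Runs t w' u) :
    Runs s (w ++ w') u := by
  induction h with
  | nil _ => exact h'
  | cons a b x w t _ ih => exact Runs.cons a b x _ _ (ih h')

theorem runs_cups (n : ℕ) :
    Runs [] ((List.range n).map (cup true))
      (List.replicate n true ++ List.replicate n false) := by
  induction n with
  | zero => exact Runs.nil _
  | succ n ih =>
    rw [List.range_succ, List.map_append]
    refine ih.append ?_
    have h := Runs.cons (List.replicate n true) (List.replicate n false) (.cup true) [] _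
      (Runs.nil _)
    have e : List.replicate (n + 1) true ++ List.replicate (n + 1) false =
        List.replicate n true ++ [true, false] ++ List.replicate n false := by
      rw [List.replicate_succ' (n := n) (a := true), List.replicate_succ]
      simp
    rw [e]
    simpa [Piece.bottom, Piece.top] using h

theorem runs_caps (n : ℕ) :
    Runs (List.replicate n true ++ List.replicate n false)
      ((List.range n).reverse.map (cap true)) [] := by
  induction n with
  | zero => exact Runs.nil _
  | succ n ih =>
    rw [List.range_succ, List.reverse_append]
    have h := Runs.cons (List.replicate n true) (List.replicate n false) (.cap true) _ _
      (by simpa [Piece.top] using ih)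
    have e : List.replicate (n + 1) true ++ List.replicate (n + 1) false =
        List.replicate n true ++ [true, false] ++ List.replicate n false := by
      rw [List.replicate_succ' (n := n) (a := true), List.replicate_succ]
      simp
    rw [e]
    simpa [Piece.bottom] using h

theorem runs_braid (n : ℕ) (β : BraidWord n) (b : List Bool) :
    Runs (List.replicate n true ++ b) (β.map (fun x => X x.2 x.1)) (List.replicate n true ++ b) := by
  induction β with
  | nil => exact Runs.nil _
  | cons x β ih =>
    have hx := x.1.isLt
    obtain ⟨m, hm⟩ : ∃ m, n = x.1 + 2 + m := ⟨n - (x.1 + 2), by omega⟩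
    have e : List.replicate n true ++ b =
        List.replicate x.1 true ++ [true, true] ++ (List.replicate m true ++ b) := by
      conv_lhs => rw [hm, List.replicate_add, List.replicate_add]
      simp [List.replicate_succ]
    have h := Runs.cons (List.replicate x.1 true) (List.replicate m true ++ b)
      (.crossing x.2) (β.map (fun x => X x.2 x.1)) (List.replicate n true ++ b)
      (by simp only [Piece.top]; rw [← e]; exact ih)
    simp only [Piece.bottom] at h
    rw [← e] at h
    simpa using h

/-- The closure `L(β)` of a braid. -/
def braidClosure {n : ℕ} (β : BraidWord n) : LinkDiagram where
  events := closureEvents n β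
  closed := ((runs_cups n).append (runs_braid n β _)).append (runs_caps n)

end Homflypt

/-! The degree bound is the upper Morton–Franks–Williams inequality for positive braids: every
exponent of `v` in $P_{L(\beta)}$ is at most $n+e-1$, in every coefficient of `z`. The factor
$v^{1-\#L}$ in the definition of $p^0$ then turns $n+e-1$ into $n+e-\#L$, whatever the value of
$\#L$.

The inequality is an induction on the number of strands (`hasVDegreeLE_wordClosure`). Braid
relations are isotopies, and the skein relation on one letter of $\sigma_i\sigma_i$ gives
$P_{a\sigma_i\sigma_i c}=v^2P_{ac}+vz\,P_{a\sigma_i c}$. The bound survives this step: deleting $k$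
letters lowers it by $k$, and the coefficients restore exactly that. These relations reduce every
positive word to words that contain the largest letter at most once
(`IsHeckeClosed.of_count_le_one`). If it occurs once, a first Reidemeister move removes it together
with the last strand. If it does not occur, the last strand closes to a separate circle, which
contributes the factor $(v^{-1}-v)z^{-1}$ and raises the bound by one (`HasVDegreeLE.circle`).

The reduction computes some polynomial that the skein relations force on the diagram. Since `homfly`
is an arbitrary choice among the forced values, uniqueness is also needed: a multiple of the unknot
that vanishes in the skein module has coefficient zero (`eq_zero_of_single_unknot_mem`). It follows
from the $\mathfrak{sl}_N$ state sums built from the Hecke-type `R`-matrix. For each $N\ge1$ and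
$q>0$ they are isotopy invariants satisfying the skein relation at $v=q^{-N}$, $z=q-q^{-1}$, and
they are nonzero on the unknot. Fixing a transcendental `v` and letting `N` vary gives infinitely
many values of `z`, enough to detect any nonzero Laurent polynomial. -/

namespace Homflypt

open scoped LaurentPolynomial

/-! ### The `R`-matrix state sum -/

section StateSum

variable {N : ℕ}

/-- The weight of a label on a closed loop. -/
noncomputable def loopWeight (q : ℝ) (i : Fin N) : ℝ := q ^ (2 * (i : ℤ) + 1 - N)

/-- The weight of a local minimum whose branches carry the label `i`. -/
noncomputable def cupWeight (q : ℝ) (ε : Bool) (i : Fin N) : ℝ :=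
  if ε then 1 else (loopWeight q i)⁻¹

/-- The weight of a local maximum whose branches carry the label `i`. -/
noncomputable def capWeight (q : ℝ) (ε : Bool) (i : Fin N) : ℝ :=
  if ε then loopWeight q i else 1

/-- The difference between the `R`-matrix (or its inverse) and the flip is diagonal; these are its
diagonal entries. -/
noncomputable def crossingCoeff (q : ℝ) (s : Bool) (i j : Fin N) : ℝ :=
  if s then (if i < j then q - q⁻¹ else if i = j then q - 1 else 0)
  else (if j < i then -(q - q⁻¹) else if i = j then q⁻¹ - 1 else 0)

/-- The framing correction of a crossing. -/
noncomputable def crossingScale (N : ℕ) (q : ℝ) (s : Bool) : ℝ :=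
  if s then (q ^ N)⁻¹ else q ^ N

/-- The operator of an elementary piece at the left end of a row of labelled strands. -/
noncomputable def pieceOp (q : ℝ) : Piece → (List (Fin N) → ℝ) → List (Fin N) → ℝ
  | .crossing s, g, i :: j :: t =>
      crossingScale N q s * (g (j :: i :: t) + crossingCoeff q s i j * g (i :: j :: t))
  | .crossing _, _, _ => 0
  | .cup ε, g, t => ∑ i, cupWeight q ε i * g (i :: i :: t)
  | .cap ε, g, i :: j :: t => if i = j then capWeight q ε i * g t else 0
  | .cap _, _, _ => 0

/-- The operator of an elementary piece with `p` strands to the left of it. -/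
noncomputable def pieceOpAt (q : ℝ) (x : Piece) : ℕ → (List (Fin N) → ℝ) → List (Fin N) → ℝ
  | 0, g, s => pieceOp q x g s
  | _ + 1, _, [] => 0
  | p + 1, g, h :: t => pieceOpAt q x p (fun s => g (h :: s)) t

/-- The operator of a stack of events. -/
noncomputable def eventsOp (q : ℝ) : List Event → (List (Fin N) → ℝ) → List (Fin N) → ℝ
  | [], g => g
  | e :: w, g => pieceOpAt q e.piece e.pos (eventsOp q w g)

/-! ### Linearity and locality of the operators -/

theorem pieceOp_linear (q : ℝ) (x : Piece) (a b : ℝ) (g h : List (Fin N) → ℝ)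
    (s : List (Fin N)) :
    pieceOp q x (fun s => a * g s + b * h s) s = a * pieceOp q x g s + b * pieceOp q x h s := by
  rcases x with σ | ε | ε
  · rcases s with _ | ⟨i, _ | ⟨j, t⟩⟩ <;> simp only [pieceOp] <;> ring
  · simp only [pieceOp, Finset.mul_sum, ← Finset.sum_add_distrib]
    exact Finset.sum_congr rfl fun _ _ => by ring
  · rcases s with _ | ⟨i, _ | ⟨j, t⟩⟩ <;> simp only [pieceOp]
    · ring
    · ring
    · split_ifs <;> ring

theorem pieceOpAt_linear (q : ℝ) (x : Piece) (p : ℕ) (a b : ℝ) (g h : List (Fin N) → ℝ)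
    (s : List (Fin N)) :
    pieceOpAt q x p (fun s => a * g s + b * h s) s =
      a * pieceOpAt q x p g s + b * pieceOpAt q x p h s := by
  induction p generalizing g h s with
  | zero => exact pieceOp_linear q x a b g h s
  | succ p ih =>
    rcases s with _ | ⟨k, t⟩
    · simp [pieceOpAt]
    · exact ih _ _ _

theorem pieceOpAt_mul (q : ℝ) (x : Piece) (p : ℕ) (a : ℝ) (g : List (Fin N) → ℝ)
    (s : List (Fin N)) :
    pieceOpAt q x p (fun s => a * g s) s = a * pieceOpAt q x p g s := by
  simpa using pieceOpAt_linear q x p a 0 g g s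

theorem pieceOpAt_zero (q : ℝ) (x : Piece) (p : ℕ) (s : List (Fin N)) :
    pieceOpAt q x p (fun _ => 0) s = 0 := by
  simpa using pieceOpAt_linear q x p 0 0 (fun _ => 0) (fun _ => 0) s

theorem pieceOpAt_sum {ι : Type*} (A : Finset ι) (q : ℝ) (x : Piece) (p : ℕ)
    (c : ι → ℝ) (g : ι → List (Fin N) → ℝ) (s : List (Fin N)) :
    pieceOpAt q x p (fun s => ∑ i ∈ A, c i * g i s) s =
      ∑ i ∈ A, c i * pieceOpAt q x p (g i) s := by
  classical
  induction A using Finset.induction_on with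
  | empty => simp [pieceOpAt_zero]
  | insert a A ha ih =>
    simp only [Finset.sum_insert ha, ← ih]
    simpa using pieceOpAt_linear q x p (c a) 1 (g a) (fun s => ∑ i ∈ A, c i * g i s) s

theorem eventsOp_append (q : ℝ) (w w' : List Event) (g : List (Fin N) → ℝ) :
    eventsOp q (w ++ w') g = eventsOp q w (eventsOp q w' g) := by
  induction w with
  | nil => rfl
  | cons e w ih => simp [eventsOp, ih]

/-- A linear relation between three functions on rows is preserved by the operator of a piece. -/
theorem pieceOp_relation (q : ℝ) (x : Piece) {a b c : ℝ} {f g h : List (Fin N) → ℝ} {n : ℕ}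
    (H : ∀ s, s.length = n + x.top.length → a * f s + b * g s + c * h s = 0)
    {s : List (Fin N)} (hs : s.length = n + x.bottom.length) :
    a * pieceOp q x f s + b * pieceOp q x g s + c * pieceOp q x h s = 0 := by
  rcases x with σ | ε | ε
  · rcases s with _ | ⟨i, _ | ⟨j, t⟩⟩
    · simp [pieceOp]
    · simp [pieceOp]
    · simp only [Piece.bottom, Piece.top, List.length_cons, List.length_nil] at hs H
      simp only [pieceOp]
      linear_combination crossingScale N q σ * H (j :: i :: t) (by simp; omega) +
        crossingScale N q σ * crossingCoeff q σ i j * H (i :: j :: t) (by simp; omega)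
  · simp only [Piece.bottom, Piece.top, List.length_cons, List.length_nil] at hs H
    simp only [pieceOp, Finset.mul_sum, ← Finset.sum_add_distrib]
    refine Finset.sum_eq_zero fun i _ => ?_
    linear_combination cupWeight q ε i * H (i :: i :: s) (by simp; omega)
  · rcases s with _ | ⟨i, _ | ⟨j, t⟩⟩
    · simp [pieceOp]
    · simp [pieceOp]
    · simp only [Piece.bottom, Piece.top, List.length_cons, List.length_nil] at hs H
      simp only [pieceOp]
      split_ifs
      · linear_combination capWeight q ε i * H t (by omega)
      · ring

theorem pieceOpAt_relation (q : ℝ) (x : Piece) {a b c : ℝ} {f g h : List (Fin N) → ℝ} {n p : ℕ}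
    (hp : p ≤ n)
    (H : ∀ s, s.length = n + x.top.length → a * f s + b * g s + c * h s = 0)
    {s : List (Fin N)} (hs : s.length = n + x.bottom.length) :
    a * pieceOpAt q x p f s + b * pieceOpAt q x p g s + c * pieceOpAt q x p h s = 0 := by
  induction p generalizing f g h s n with
  | zero => exact pieceOp_relation q x H hs
  | succ p ih =>
    obtain ⟨n, rfl⟩ : ∃ m, n = m + 1 := ⟨n - 1, by omega⟩
    rcases s with _ | ⟨k, t⟩
    · simp [pieceOpAt]
    · refine ih (n := n) (by omega) (fun s hs => H _ ?_) ?_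
      · simp; omega
      · simp at hs; omega

/-- Carries a local identity in the middle of a diagram down through the events below it. The
coefficients `1, -1, 0` serve isotopy invariance, and three nonzero ones the skein relation. Only
rows of the right length are compared, because operators vanish on rows that are too short and the
local identities fail there. -/
theorem eventsOp_relation (q : ℝ) {w : List Event} {t u : List Bool} (hw : Runs t w u)
    {a b c : ℝ} {f g h : List (Fin N) → ℝ}
    (H : ∀ s, s.length = u.length → a * f s + b * g s + c * h s = 0)
    {s : List (Fin N)} (hs : s.length = t.length) :
    a * eventsOp q w f s + b * eventsOp q w g s + c * eventsOp q w h s = 0 := by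
  induction hw generalizing s with
  | nil _ => exact H s hs
  | cons l r x w t _ ih =>
    refine pieceOpAt_relation q x (n := l.length + r.length) (by simp) (fun s hs => ih H ?_) ?_
    · simp; omega
    · simp at hs; omega

theorem Runs.cons_inv {e : Event} {w : List Event} {t u : List Bool} (h : Runs t (e :: w) u) :
    ∃ t', Runs t' w u ∧ e.pos + e.piece.bottom.length ≤ t.length ∧
      t'.length + e.piece.bottom.length = t.length + e.piece.top.length := by
  cases h with
  | cons a b x w t h => exact ⟨_, h, by simp, by simp; omega⟩

theorem Runs.append_inv {w w' : List Event} {t u : List Bool} (h : Runs t (w ++ w') u) :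
    ∃ m, Runs t w m ∧ Runs m w' u := by
  induction w generalizing t with
  | nil => exact ⟨t, Runs.nil _, h⟩
  | cons e w ih =>
    cases h with
    | cons a b x w t h =>
      obtain ⟨m, h1, h2⟩ := ih h
      exact ⟨m, Runs.cons _ _ _ _ _ h1, h2⟩

theorem eventsOp_shift (q : ℝ) (w : List Event) (g : List (Fin N) → ℝ) (h : Fin N)
    (t : List (Fin N)) :
    eventsOp q (w.map fun e => ⟨e.piece, e.pos + 1⟩) g (h :: t) =
      eventsOp q w (fun s => g (h :: s)) t := by
  induction w generalizing t with
  | nil => rfl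
  | cons e w ih =>
    simp only [List.map_cons, eventsOp, pieceOpAt]
    congr 1
    funext s
    exact ih s

/-- An identity between operators at the left end of a row holds everywhere in the row. -/
theorem eventsOp_eq_of_shift (q : ℝ) {x y : ℕ → List Event} {c : ℕ}
    (hx : ∀ p, x (p + 1) = (x p).map fun e => ⟨e.piece, e.pos + 1⟩)
    (hy : ∀ p, y (p + 1) = (y p).map fun e => ⟨e.piece, e.pos + 1⟩)
    (h0 : ∀ (g : List (Fin N) → ℝ) s, c ≤ s.length → eventsOp q (x 0) g s = eventsOp q (y 0) g s)
    (p : ℕ) (g : List (Fin N) → ℝ) (s : List (Fin N)) (hs : p + c ≤ s.length) :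
    eventsOp q (x p) g s = eventsOp q (y p) g s := by
  induction p generalizing g s with
  | zero => exact h0 g s (by omega)
  | succ p ih =>
    rcases s with _ | ⟨h, t⟩
    · simp at hs
    · rw [hx, hy, eventsOp_shift, eventsOp_shift]
      exact ih _ _ (by simp at hs; omega)

/-! ### Telescoping sums over labels -/

theorem sum_fin_of_step (S : ℕ → ℝ) (F : Fin N → ℝ) (h0 : S 0 = 0)
    (h : ∀ k : Fin N, S (k + 1) = S k + F k) : ∑ k, F k = S N := by
  have h1 : ∀ k : Fin N, F k = (fun n => S (n + 1) - S n) (k : ℕ) := fun k => by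
    simp only [h k]; ring
  rw [Finset.sum_congr rfl fun k _ => h1 k, ← Finset.sum_range (fun n => S (n + 1) - S n),
    Finset.sum_range_sub, h0, sub_zero]

/-- The even powers of `q` between consecutive loop weights. -/
noncomputable def stepWeight (N : ℕ) (q : ℝ) (n : ℕ) : ℝ := q ^ (2 * (n : ℤ) - N)

variable {q : ℝ}

theorem stepWeight_ne_zero (hq : q ≠ 0) (n : ℕ) : stepWeight N q n ≠ 0 := zpow_ne_zero _ hq

theorem stepWeight_succ (hq : q ≠ 0) (n : ℕ) :
    stepWeight N q (n + 1) = q ^ 2 * stepWeight N q n := by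
  rw [stepWeight, stepWeight, ← zpow_natCast, ← zpow_add₀ hq]
  congr 1; push_cast; ring

theorem stepWeight_zero : stepWeight N q 0 = (q ^ N)⁻¹ := by
  simp [stepWeight]

theorem stepWeight_self : stepWeight N q N = q ^ N := by
  rw [stepWeight, ← zpow_natCast]
  congr 1; ring

theorem loopWeight_eq (hq : q ≠ 0) (i : Fin N) : loopWeight q i = q * stepWeight N q i := by
  rw [stepWeight, loopWeight, ← zpow_one_add₀ hq]
  congr 1; ring

/-- The partial trace of the diagonal part of the `R`-matrix, needed for a kink on the right. Since
$(q-q^{-1})\,$`loopWeight k` is the difference of `stepWeight` at `k + 1` and at `k`, the sum over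
labels on one side of `i` telescopes. The term `k = i` replaces the inner boundary value by
`loopWeight q i`, and the outer boundary value is the framing factor. -/
theorem sum_crossingCoeff_mul_loopWeight (hq : q ≠ 0) (s : Bool) (i : Fin N) :
    ∑ k, crossingCoeff q s i k * loopWeight q k =
      (crossingScale N q s)⁻¹ - loopWeight q i := by
  have hi := i.isLt
  rcases s with _ | _
  -- The function supplied is the sum over labels below `n`; it is constant once `n` exceeds `i`.
  · rw [sum_fin_of_step (fun n => if n ≤ i then stepWeight N q 0 - stepWeight N q n
      else stepWeight N q 0 - loopWeight q i)]
    · simp [crossingScale, hi, stepWeight_zero]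
    · simp
    · intro k
      rcases lt_trichotomy k i with h | rfl | h
      · have h1 : (k : ℕ) < i := h
        simp [crossingCoeff, h, h1.le, Nat.succ_le_of_lt h1, stepWeight_succ hq, loopWeight_eq hq]
        field_simp; ring
      · simp [crossingCoeff, loopWeight_eq hq]
        field_simp; ring
      · have h1 : (i : ℕ) < k := h
        simp [crossingCoeff, h.not_gt, h.ne, h1.not_ge, (h1.trans (Nat.lt_succ_self _)).not_ge]
  · rw [sum_fin_of_step (fun n => if n ≤ i then 0 else stepWeight N q n - loopWeight q i)]
    · simp [crossingScale, hi, stepWeight_self]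
    · simp
    · intro k
      rcases lt_trichotomy k i with h | rfl | h
      · have h1 : (k : ℕ) < i := h
        simp [crossingCoeff, h.not_gt, h.ne', h1.le, Nat.succ_le_of_lt h1]
      · simp [crossingCoeff, loopWeight_eq hq, stepWeight_succ hq]
        field_simp
      · have h1 : (i : ℕ) < k := h
        simp [crossingCoeff, h, h1.not_ge, (h1.trans (Nat.lt_succ_self _)).not_ge,
          stepWeight_succ hq, loopWeight_eq hq]
        field_simp; ring

theorem sum_inv_loopWeight_mul_crossingCoeff (hq : q ≠ 0) (s : Bool) (i : Fin N) :
    ∑ k, (loopWeight q k)⁻¹ * crossingCoeff q s k i =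
      (crossingScale N q s)⁻¹ - (loopWeight q i)⁻¹ := by
  have hi := i.isLt
  have hE := stepWeight_ne_zero (N := N) hq
  rcases s with _ | _
  · rw [sum_fin_of_step (fun n => if n ≤ i then 0 else (stepWeight N q n)⁻¹ - (loopWeight q i)⁻¹)]
    · simp [crossingScale, hi, stepWeight_self]
    · simp
    · intro k
      have hk := hE k
      rcases lt_trichotomy k i with h | rfl | h
      · have h1 : (k : ℕ) < i := h
        simp [crossingCoeff, h.not_gt, h.ne, h1.le, Nat.succ_le_of_lt h1]
      · simp [crossingCoeff, loopWeight_eq hq, stepWeight_succ hq]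
        field_simp
      · have h1 : (i : ℕ) < k := h
        simp [crossingCoeff, h, h1.not_ge, (h1.trans (Nat.lt_succ_self _)).not_ge,
          stepWeight_succ hq, loopWeight_eq hq]
        field_simp; ring
  · rw [sum_fin_of_step (fun n => if n ≤ i then (stepWeight N q 0)⁻¹ - (stepWeight N q n)⁻¹
      else (stepWeight N q 0)⁻¹ - (loopWeight q i)⁻¹)]
    · simp [crossingScale, hi, stepWeight_zero]
    · simp
    · intro k
      have hk := hE k
      rcases lt_trichotomy k i with h | rfl | h
      · have h1 : (k : ℕ) < i := h
        simp [crossingCoeff, h, h1.le, Nat.succ_le_of_lt h1, stepWeight_succ hq, loopWeight_eq hq]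
        field_simp; ring
      · simp [crossingCoeff, loopWeight_eq hq]
        field_simp; ring
      · have h1 : (i : ℕ) < k := h
        simp [crossingCoeff, h.not_gt, h.ne', h1.not_ge, (h1.trans (Nat.lt_succ_self _)).not_ge]

/-- The product of the two coefficients vanishes unless `m ≤ k ≤ i`. For `i < m` both sides are
zero, for `i = m` one term is left, and for `m < i` the inner terms telescope, while the two end
terms have their own coefficients. -/
theorem sum_inv_loopWeight_mul_crossingCoeff_mul (hq : q ≠ 0) (i m : Fin N) :
    ∑ k, (loopWeight q k)⁻¹ * crossingCoeff q true k i * crossingCoeff q false k m =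
      - (loopWeight q i)⁻¹ * crossingCoeff q false i m
        - (loopWeight q m)⁻¹ * crossingCoeff q true m i := by
  have hi := i.isLt
  have hm := m.isLt
  have hE := stepWeight_ne_zero (N := N) hq
  rcases lt_trichotomy i m with h | rfl | h
  · rw [Finset.sum_eq_zero]
    · simp [crossingCoeff, h.not_gt, h.ne, h.ne']
    · intro k _
      simp only [crossingCoeff, if_true, Bool.false_eq_true, if_false]
      simp only [Fin.lt_def, Fin.ext_iff] at *
      split_ifs <;> first | omega | simp
  · rw [Finset.sum_eq_single i]
    · have := hE i
      simp [crossingCoeff, loopWeight_eq hq]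
      field_simp; ring
    · intro k _ hk
      rcases lt_or_gt_of_ne hk with h | h <;> simp [crossingCoeff, h.not_gt, h.ne, h.ne']
    · simp
  · have hmi : (m : ℕ) < i := h
    rw [sum_fin_of_step (fun n => if n ≤ m then 0 else if n ≤ i then
      (q - q⁻¹) * ((stepWeight N q n)⁻¹ - (loopWeight q m)⁻¹) else
      (q - q⁻¹) * ((loopWeight q i)⁻¹ - (loopWeight q m)⁻¹))]
    · simp [crossingCoeff, hi.not_ge, hm.not_ge, h]
      ring
    · simp
    · intro k
      have hk := hE k
      rcases lt_trichotomy k m with h1 | rfl | h1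
      · have h2 : (k : ℕ) < m := h1
        simp [crossingCoeff, h1.not_gt, h1.ne, h2.le, Nat.succ_le_of_lt h2]
      · simp [crossingCoeff, h, Nat.succ_le_of_lt hmi, stepWeight_succ hq, loopWeight_eq hq]
        field_simp
      · have h2 : (m : ℕ) < k := h1
        rcases lt_trichotomy k i with h3 | rfl | h3
        · have h4 : (k : ℕ) < i := h3
          simp [crossingCoeff, h1, h3, h2.not_ge, (h2.trans (Nat.lt_succ_self _)).not_ge,
            h4.le, Nat.succ_le_of_lt h4, stepWeight_succ hq, loopWeight_eq hq]
          have := hE m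
          field_simp; ring
        · simp [crossingCoeff, h1, h2.not_ge, (h2.trans (Nat.lt_succ_self _)).not_ge,
            loopWeight_eq hq]
          have := hE m
          field_simp; ring
        · have h4 : (i : ℕ) < k := h3
          simp [crossingCoeff, h3.not_gt, h3.ne', h2.not_ge,
            (h2.trans (Nat.lt_succ_self _)).not_ge, h4.not_ge,
            (h4.trans (Nat.lt_succ_self _)).not_ge]

/-- The mirror case: here only labels with `i ≤ k ≤ m` contribute, and the weights are not inverted.
-/
theorem sum_loopWeight_mul_crossingCoeff_mul (hq : q ≠ 0) (i m : Fin N) :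
    ∑ k, loopWeight q k * crossingCoeff q true i k * crossingCoeff q false m k =
      - loopWeight q i * crossingCoeff q false m i
        - loopWeight q m * crossingCoeff q true i m := by
  have hi := i.isLt
  have hm := m.isLt
  rcases lt_trichotomy m i with h | rfl | h
  · rw [Finset.sum_eq_zero]
    · simp [crossingCoeff, h.not_gt, h.ne, h.ne']
    · intro k _
      simp only [crossingCoeff, if_true, Bool.false_eq_true, if_false]
      simp only [Fin.lt_def, Fin.ext_iff] at *
      split_ifs <;> first | omega | simp
  · rw [Finset.sum_eq_single m]
    · simp [crossingCoeff, loopWeight_eq hq]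
      field_simp; ring
    · intro k _ hk
      rcases lt_or_gt_of_ne hk with h | h <;> simp [crossingCoeff, h.not_gt, h.ne, h.ne']
    · simp
  · have him : (i : ℕ) < m := h
    rw [sum_fin_of_step (fun n => if n ≤ i then 0 else if n ≤ m then
      (q - q⁻¹) * (loopWeight q i - stepWeight N q n) else
      (q - q⁻¹) * (loopWeight q i - loopWeight q m))]
    · simp [crossingCoeff, hi.not_ge, hm.not_ge, h]
      ring
    · simp
    · intro k
      rcases lt_trichotomy k i with h1 | rfl | h1
      · have h2 : (k : ℕ) < i := h1
        simp [crossingCoeff, h1.not_gt, h1.ne', h2.le, Nat.succ_le_of_lt h2]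
      · simp [crossingCoeff, h, Nat.succ_le_of_lt him, stepWeight_succ hq, loopWeight_eq hq]
        field_simp; ring
      · have h2 : (i : ℕ) < k := h1
        rcases lt_trichotomy k m with h3 | rfl | h3
        · have h4 : (k : ℕ) < m := h3
          simp [crossingCoeff, h1, h3, h2.not_ge, (h2.trans (Nat.lt_succ_self _)).not_ge,
            h4.le, Nat.succ_le_of_lt h4, stepWeight_succ hq, loopWeight_eq hq]
          field_simp; ring
        · simp [crossingCoeff, h1, h2.not_ge, (h2.trans (Nat.lt_succ_self _)).not_ge,
            loopWeight_eq hq]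
          field_simp; ring
        · have h4 : (m : ℕ) < k := h3
          simp [crossingCoeff, h3.not_gt, h3.ne, h2.not_ge,
            (h2.trans (Nat.lt_succ_self _)).not_ge, h4.not_ge,
            (h4.trans (Nat.lt_succ_self _)).not_ge]

/-! ### Invariance of the operators under the elementary moves -/

theorem crossingScale_ne_zero (hq : q ≠ 0) (s : Bool) : crossingScale N q s ≠ 0 := by
  cases s <;> simp [crossingScale, hq]

theorem crossingScale_mul_not (hq : q ≠ 0) (s : Bool) :
    crossingScale N q s * crossingScale N q (!s) = 1 := by
  cases s <;> simp [crossingScale, hq]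

theorem loopWeight_ne_zero (hq : q ≠ 0) (i : Fin N) : loopWeight q i ≠ 0 := zpow_ne_zero _ hq

theorem cupWeight_not_mul_capWeight (hq : q ≠ 0) (ε : Bool) (i : Fin N) :
    cupWeight q (!ε) i * capWeight q ε i = 1 := by
  have := loopWeight_ne_zero hq i
  cases ε <;> simp [cupWeight, capWeight, this]

theorem cupWeight_mul_capWeight_not (hq : q ≠ 0) (ε : Bool) (i : Fin N) :
    cupWeight q ε i * capWeight q (!ε) i = 1 := by
  have := loopWeight_ne_zero hq i
  cases ε <;> simp [cupWeight, capWeight, this]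

theorem exists_cons_of_one_le {α : Type*} {s : List α} (h : 1 ≤ s.length) :
    ∃ i t, s = i :: t := by
  rcases s with _ | ⟨i, t⟩
  · simp at h
  · exact ⟨i, t, rfl⟩

theorem exists_cons_cons_of_two_le {α : Type*} {s : List α} (h : 2 ≤ s.length) :
    ∃ i j t, s = i :: j :: t := by
  obtain ⟨i, s, rfl⟩ := exists_cons_of_one_le (by omega : 1 ≤ s.length)
  obtain ⟨j, t, rfl⟩ := exists_cons_of_one_le (by simpa using h : 1 ≤ s.length)
  exact ⟨i, j, t, rfl⟩

theorem exists_cons_cons_cons_of_three_le {α : Type*} {s : List α} (h : 3 ≤ s.length) :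
    ∃ i j k t, s = i :: j :: k :: t := by
  obtain ⟨i, s, rfl⟩ := exists_cons_of_one_le (by omega : 1 ≤ s.length)
  obtain ⟨j, k, t, rfl⟩ := exists_cons_cons_of_two_le (by simpa using h : 2 ≤ s.length)
  exact ⟨i, j, k, t, rfl⟩

theorem eventsOp_zigzag_left (hq : q ≠ 0) (ε : Bool) (p : ℕ) (g : List (Fin N) → ℝ)
    (s : List (Fin N)) (hs : p + 1 ≤ s.length) :
    eventsOp q [cup (!ε) (p + 1), cap ε p] g s = eventsOp q [] g s := by
  refine eventsOp_eq_of_shift q (x := fun p => [cup (!ε) (p + 1), cap ε p]) (y := fun _ => [])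
    (fun _ => rfl) (fun _ => rfl) (fun g s hs => ?_) p g s hs
  obtain ⟨i, t, rfl⟩ := exists_cons_of_one_le hs
  simp only [eventsOp, pieceOpAt, pieceOp, mul_ite, mul_zero, Finset.sum_ite_eq,
    Finset.mem_univ, if_true]
  linear_combination g (i :: t) * cupWeight_not_mul_capWeight hq ε i

theorem eventsOp_zigzag_right (hq : q ≠ 0) (ε : Bool) (p : ℕ) (g : List (Fin N) → ℝ)
    (s : List (Fin N)) (hs : p + 1 ≤ s.length) :
    eventsOp q [cup ε p, cap (!ε) (p + 1)] g s = eventsOp q [] g s := by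
  refine eventsOp_eq_of_shift q (x := fun p => [cup ε p, cap (!ε) (p + 1)]) (y := fun _ => [])
    (fun _ => rfl) (fun _ => rfl) (fun g s hs => ?_) p g s hs
  obtain ⟨i, t, rfl⟩ := exists_cons_of_one_le hs
  simp only [eventsOp, pieceOpAt, pieceOp, mul_ite, mul_zero, Finset.sum_ite_eq',
    Finset.mem_univ, if_true]
  linear_combination g (i :: t) * cupWeight_mul_capWeight_not hq ε i

/-- A crossing only permutes its labels, so on the first side the inverse loop weights of the two
minima cancel the loop weights of the two maxima. On the second side all these weights are `1`. -/
theorem eventsOp_rotate (hq : q ≠ 0) (s : Bool) (p : ℕ) (g : List (Fin N) → ℝ)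
    (r : List (Fin N)) (hr : p + 2 ≤ r.length) :
    eventsOp q [cup false p, cup false (p + 1), X s (p + 2), cap true (p + 3), cap true (p + 2)] g r =
      eventsOp q [cup true (p + 2), cup true (p + 3), X s (p + 2), cap false (p + 1), cap false p]
        g r := by
  refine eventsOp_eq_of_shift q
    (x := fun p => [cup false p, cup false (p + 1), X s (p + 2), cap true (p + 3), cap true (p + 2)])
    (y := fun p => [cup true (p + 2), cup true (p + 3), X s (p + 2), cap false (p + 1), cap false p])
    (fun _ => rfl) (fun _ => rfl) (fun g s hs => ?_) p g r hr
  obtain ⟨i, j, t, rfl⟩ := exists_cons_cons_of_two_le hs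
  have hi := loopWeight_ne_zero hq i
  have hj := loopWeight_ne_zero hq j
  simp [eventsOp, pieceOpAt, pieceOp, cupWeight, capWeight, mul_add, Finset.sum_add_distrib]
  field_simp

theorem eventsOp_reidemeister1_right (hq : q ≠ 0) (s : Bool) (p : ℕ) (g : List (Fin N) → ℝ)
    (r : List (Fin N)) (hr : p + 1 ≤ r.length) :
    eventsOp q [cup true (p + 1), X s p, cap true (p + 1)] g r = eventsOp q [] g r := by
  refine eventsOp_eq_of_shift q (x := fun p => [cup true (p + 1), X s p, cap true (p + 1)])
    (y := fun _ => []) (fun _ => rfl) (fun _ => rfl) (fun g s hs => ?_) p g r hr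
  obtain ⟨i, t, rfl⟩ := exists_cons_of_one_le hs
  have h1 := sum_crossingCoeff_mul_loopWeight hq s i
  have h2 := crossingScale_ne_zero (N := N) hq s
  simp [eventsOp, pieceOpAt, pieceOp, cupWeight, capWeight, mul_add, Finset.sum_add_distrib]
  rw [← Finset.mul_sum]
  simp only [← mul_assoc]
  rw [← Finset.sum_mul, h1]
  field_simp
  ring

theorem eventsOp_reidemeister1_left (hq : q ≠ 0) (s : Bool) (p : ℕ) (g : List (Fin N) → ℝ)
    (r : List (Fin N)) (hr : p + 1 ≤ r.length) :
    eventsOp q [cup false p, X s (p + 1), cap false p] g r = eventsOp q [] g r := by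
  refine eventsOp_eq_of_shift q (x := fun p => [cup false p, X s (p + 1), cap false p])
    (y := fun _ => []) (fun _ => rfl) (fun _ => rfl) (fun g s hs => ?_) p g r hr
  obtain ⟨i, t, rfl⟩ := exists_cons_of_one_le hs
  have h1 := sum_inv_loopWeight_mul_crossingCoeff hq s i
  have h2 := crossingScale_ne_zero (N := N) hq s
  have h3 : ∑ k, (loopWeight q k)⁻¹ * (crossingScale N q s * (crossingCoeff q s k i * g (i :: t)))
      = crossingScale N q s * g (i :: t) * ∑ k, (loopWeight q k)⁻¹ * crossingCoeff q s k i := by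
    rw [Finset.mul_sum]
    exact Finset.sum_congr rfl fun _ _ => by ring
  simp [eventsOp, pieceOpAt, pieceOp, cupWeight, capWeight, mul_add, Finset.sum_add_distrib]
  rw [h3, h1]
  field_simp
  ring

theorem eventsOp_reidemeister2 (hq : q ≠ 0) (s : Bool) (p : ℕ) (g : List (Fin N) → ℝ)
    (r : List (Fin N)) (hr : p + 2 ≤ r.length) :
    eventsOp q [X s p, X (!s) p] g r = eventsOp q [] g r := by
  refine eventsOp_eq_of_shift q (x := fun p => [X s p, X (!s) p])
    (y := fun _ => []) (fun _ => rfl) (fun _ => rfl) (fun g r hr => ?_) p g r hr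
  obtain ⟨i, j, t, rfl⟩ := exists_cons_cons_of_two_le hr
  simp only [eventsOp, pieceOpAt, pieceOp]
  rcases lt_trichotomy i j with h | rfl | h
  · cases s <;> simp [crossingCoeff, h, h.not_gt, h.ne, h.ne'] <;> simp [crossingScale] <;>
      field_simp <;> ring
  · cases s <;> simp [crossingCoeff] <;> simp [crossingScale] <;> field_simp <;> ring
  · cases s <;> simp [crossingCoeff, h, h.not_gt, h.ne, h.ne'] <;> simp [crossingScale] <;>
      field_simp <;> ring

/-- The Yang–Baxter equation. The coefficients depend only on the relative order of labels, so each
consistent ordering of three labels leaves an identity of rational functions in `q`. -/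
theorem eventsOp_reidemeister3 (p : ℕ) (hq : q ≠ 0) (g : List (Fin N) → ℝ)
    (r : List (Fin N)) (hr : p + 3 ≤ r.length) :
    eventsOp q [X true p, X true (p + 1), X true p] g r =
      eventsOp q [X true (p + 1), X true p, X true (p + 1)] g r := by
  refine eventsOp_eq_of_shift q (x := fun p => [X true p, X true (p + 1), X true p])
    (y := fun p => [X true (p + 1), X true p, X true (p + 1)])
    (fun _ => rfl) (fun _ => rfl) (fun g r hr => ?_) p g r hr
  obtain ⟨i, j, k, t, rfl⟩ := exists_cons_cons_cons_of_three_le hr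
  simp only [eventsOp, pieceOpAt, pieceOp]
  rcases lt_trichotomy i j with h1 | h1 | h1 <;> rcases lt_trichotomy j k with h2 | h2 | h2 <;>
    rcases lt_trichotomy i k with h3 | h3 | h3 <;>
    first
    | (exfalso; omega)
    | (subst_vars
       simp only [crossingCoeff, if_true, *, not_lt_of_gt, ne_of_lt, ne_of_gt, lt_irrefl, if_false]
       all_goals try field_simp
       all_goals try ring_nf)

/-- The sum rule behind the second Reidemeister move for strands `↑↓`. -/
theorem crossingCoeff_sum_up_down (hq : q ≠ 0) (s : Bool) (i m : Fin N) :
    (loopWeight q i)⁻¹ * crossingCoeff q (!s) i m + (loopWeight q m)⁻¹ * crossingCoeff q s m i +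
      ∑ k, (loopWeight q k)⁻¹ * crossingCoeff q s k i * crossingCoeff q (!s) k m = 0 := by
  cases s
  · have h := sum_inv_loopWeight_mul_crossingCoeff_mul hq m i
    simp only [mul_right_comm _ (crossingCoeff q false _ _)]
    simp only [Bool.not_false, h]
    ring
  · simp only [Bool.not_true, sum_inv_loopWeight_mul_crossingCoeff_mul hq i m]
    ring

/-- The sum rule behind the second Reidemeister move for strands `↓↑`. -/
theorem crossingCoeff_sum_down_up (hq : q ≠ 0) (s : Bool) (i m : Fin N) :
    loopWeight q i * crossingCoeff q (!s) m i + loopWeight q m * crossingCoeff q s i m +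
      ∑ k, loopWeight q k * crossingCoeff q s i k * crossingCoeff q (!s) m k = 0 := by
  cases s
  · have h := sum_loopWeight_mul_crossingCoeff_mul hq m i
    simp only [mul_right_comm _ (crossingCoeff q false _ _)]
    simp only [Bool.not_false, h]
    ring
  · simp only [Bool.not_true, sum_loopWeight_mul_crossingCoeff_mul hq i m]
    ring

/-- A crossing turned sideways. The flip stays a flip, while the diagonal part now joins the two
lower ends and the two upper ends, hence the condition `i = j` and the sum over a new label. The
antiparallel second Reidemeister move composes this with its counterpart for the opposite rotation.
-/
theorem eventsOp_cup_crossing_cap_up_down (hq : q ≠ 0) (s : Bool) (g : List (Fin N) → ℝ)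
    (i j : Fin N) (t : List (Fin N)) :
    eventsOp q [cup false 0, X s 1, cap true 2] g (i :: j :: t) = crossingScale N q s *
      (g (j :: i :: t) + if i = j then
        ∑ k, (loopWeight q k)⁻¹ * loopWeight q j * crossingCoeff q s k i * g (k :: k :: t)
        else 0) := by
  have hj := loopWeight_ne_zero hq j
  simp only [eventsOp, pieceOpAt, pieceOp, cupWeight, capWeight, mul_add, Finset.sum_add_distrib]
  simp
  congr 1
  · field_simp
  · split_ifs
    · subst_vars
      rw [Finset.mul_sum]
      exact Finset.sum_congr rfl fun _ _ => by ring
    · simp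

theorem eventsOp_cup_crossing_cap_true_false (s : Bool) (g : List (Fin N) → ℝ)
    (i j : Fin N) (t : List (Fin N)) :
    eventsOp q [cup true 2, X s 1, cap false 0] g (i :: j :: t) = crossingScale N q s *
      (g (j :: i :: t) + if i = j then
        ∑ k, crossingCoeff q s j k * g (k :: k :: t) else 0) := by
  simp only [eventsOp, pieceOpAt, pieceOp, cupWeight, capWeight, mul_add, Finset.sum_add_distrib]
  simp
  split_ifs
  · rw [Finset.mul_sum]
  · simp

/-- Composition of two sideways crossings on a pair of equal labels. The hypothesis says that the
coefficient of each `G m` in the expanded composite is zero. In the applications `γ` is the row of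
`β` at the label of the pair. -/
theorem twisted_sum_cancel {ι : Type*} [Fintype ι] {c c' : ℝ} (hc : c * c' = 1) (g₀ : ℝ)
    (α : ι → ℝ) (β : ι → ι → ℝ) (γ : ι → ℝ) (G : ι → ℝ)
    (h : ∀ m, γ m + α m + ∑ k, α k * β k m = 0) :
    c * (c' * (g₀ + ∑ m, γ m * G m) + ∑ k, α k * (c' * (G k + ∑ m, β k m * G m))) = g₀ := by
  have h1 : ∑ k, α k * (c' * (G k + ∑ m, β k m * G m)) =
      c' * ∑ m, (α m + ∑ k, α k * β k m) * G m := by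
    simp only [mul_add, add_mul, Finset.sum_add_distrib, Finset.mul_sum, Finset.sum_mul]
    congr 1
    · exact Finset.sum_congr rfl fun _ _ => by ring
    · rw [Finset.sum_comm]
      exact Finset.sum_congr rfl fun _ _ => Finset.sum_congr rfl fun _ _ => by ring
  have h2 : ∑ m, γ m * G m + ∑ m, (α m + ∑ k, α k * β k m) * G m = 0 := by
    rw [← Finset.sum_add_distrib]
    exact Finset.sum_eq_zero fun m _ => by linear_combination G m * h m
  rw [h1]
  linear_combination c * c' * h2 + g₀ * hc

theorem eventsOp_reidemeister2_up_down (hq : q ≠ 0) (s : Bool) (p : ℕ) (g : List (Fin N) → ℝ)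
    (r : List (Fin N)) (hr : p + 2 ≤ r.length) :
    eventsOp q [cup false p, X s (p + 1), cap true (p + 2),
        cup true (p + 2), X (!s) (p + 1), cap false p] g r = eventsOp q [] g r := by
  refine eventsOp_eq_of_shift q
    (x := fun p => [cup false p, X s (p + 1), cap true (p + 2),
        cup true (p + 2), X (!s) (p + 1), cap false p])
    (y := fun _ => []) (fun _ => rfl) (fun _ => rfl) (fun g r hr => ?_) p g r hr
  obtain ⟨i, j, t, rfl⟩ := exists_cons_cons_of_two_le hr
  have hs := crossingScale_mul_not (N := N) hq s
  change eventsOp q ([cup false 0, X s 1, cap true 2] ++ [cup true 2, X (!s) 1, cap false 0])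
    g (i :: j :: t) = g (i :: j :: t)
  rw [eventsOp_append, eventsOp_cup_crossing_cap_up_down hq]
  simp only [eventsOp_cup_crossing_cap_true_false, if_true]
  by_cases hij : i = j
  · subst hij
    have hi := loopWeight_ne_zero hq i
    simp only [if_true]
    refine twisted_sum_cancel hs _ (fun k => (loopWeight q k)⁻¹ * loopWeight q i *
      crossingCoeff q s k i) (fun k m => crossingCoeff q (!s) k m) _ _ fun m => ?_
    have key := crossingCoeff_sum_up_down hq s i m
    have h1 : ∑ k, (loopWeight q k)⁻¹ * loopWeight q i * crossingCoeff q s k i *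
        crossingCoeff q (!s) k m = loopWeight q i *
        ∑ k, (loopWeight q k)⁻¹ * crossingCoeff q s k i * crossingCoeff q (!s) k m := by
      rw [Finset.mul_sum]
      exact Finset.sum_congr rfl fun _ _ => by ring
    rw [h1]
    field_simp at key ⊢
    linear_combination key
  · have hji : ¬ j = i := fun h => hij h.symm
    simp only [hij, hji, if_false]
    linear_combination g (i :: j :: t) * hs

theorem eventsOp_reidemeister2_down_up (hq : q ≠ 0) (s : Bool) (p : ℕ) (g : List (Fin N) → ℝ)
    (r : List (Fin N)) (hr : p + 2 ≤ r.length) :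
    eventsOp q [cup true (p + 2), X s (p + 1), cap false p,
        cup false p, X (!s) (p + 1), cap true (p + 2)] g r = eventsOp q [] g r := by
  refine eventsOp_eq_of_shift q
    (x := fun p => [cup true (p + 2), X s (p + 1), cap false p,
        cup false p, X (!s) (p + 1), cap true (p + 2)])
    (y := fun _ => []) (fun _ => rfl) (fun _ => rfl) (fun g r hr => ?_) p g r hr
  obtain ⟨i, j, t, rfl⟩ := exists_cons_cons_of_two_le hr
  have hs := crossingScale_mul_not (N := N) hq s
  change eventsOp q ([cup true 2, X s 1, cap false 0] ++ [cup false 0, X (!s) 1, cap true 2])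
    g (i :: j :: t) = g (i :: j :: t)
  rw [eventsOp_append, eventsOp_cup_crossing_cap_true_false]
  simp only [eventsOp_cup_crossing_cap_up_down hq, if_true]
  by_cases hij : i = j
  · subst hij
    simp only [if_true]
    refine twisted_sum_cancel hs _ (fun k => crossingCoeff q s i k)
      (fun k m => (loopWeight q m)⁻¹ * loopWeight q k * crossingCoeff q (!s) m k) _ _ fun m => ?_
    have key := crossingCoeff_sum_down_up hq s i m
    have h1 : ∑ k, crossingCoeff q s i k * ((loopWeight q m)⁻¹ * loopWeight q k *
        crossingCoeff q (!s) m k) = (loopWeight q m)⁻¹ *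
        ∑ k, loopWeight q k * crossingCoeff q s i k * crossingCoeff q (!s) m k := by
      rw [Finset.mul_sum]
      exact Finset.sum_congr rfl fun _ _ => by ring
    have hm := loopWeight_ne_zero hq m
    rw [h1]
    field_simp at key ⊢
    linear_combination key
  · have hji : ¬ j = i := fun h => hij h.symm
    simp only [hij, hji, if_false]
    linear_combination g (i :: j :: t) * hs

theorem eventsOp_interchange_zero (q : ℝ) (x y : Piece) (r : ℕ) (g : List (Fin N) → ℝ)
    (s : List (Fin N)) :
    eventsOp q [⟨y, r + x.bottom.length⟩, ⟨x, 0⟩] g s =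
      eventsOp q [⟨x, 0⟩, ⟨y, r + x.top.length⟩] g s := by
  rcases x with σ | ε | ε
  · rcases s with _ | ⟨i, _ | ⟨j, t⟩⟩
    · simp [eventsOp, pieceOpAt, pieceOp, Piece.bottom]
    · simp [eventsOp, pieceOpAt, pieceOp, Piece.bottom]
    · simp only [eventsOp, pieceOpAt, pieceOp, Piece.bottom, Piece.top, List.length_cons,
        List.length_nil, zero_add]
      rw [pieceOpAt_mul]
      have h := pieceOpAt_linear q y r 1 (crossingCoeff q σ i j) (fun s => g (j :: i :: s))
        (fun s => g (i :: j :: s)) t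
      simp only [one_mul] at h
      rw [h]
  · simp only [eventsOp, pieceOpAt, pieceOp, Piece.bottom, Piece.top, List.length_cons,
      List.length_nil, zero_add, add_zero]
    exact pieceOpAt_sum Finset.univ q y r (fun i => cupWeight q ε i)
      (fun i s => g (i :: i :: s)) s
  · rcases s with _ | ⟨i, _ | ⟨j, t⟩⟩
    · simp [eventsOp, pieceOpAt, pieceOp, Piece.bottom]
    · simp [eventsOp, pieceOpAt, pieceOp, Piece.bottom]
    · simp only [eventsOp, pieceOpAt, pieceOp, Piece.bottom, Piece.top, List.length_cons,
        List.length_nil, zero_add, add_zero]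
      split_ifs
      · exact pieceOpAt_mul q y r (capWeight q ε i) g t
      · exact pieceOpAt_zero q y r t

theorem eventsOp_interchange (q : ℝ) (x y : Piece) (p r : ℕ) (h : p + x.bottom.length ≤ r)
    (g : List (Fin N) → ℝ) (s : List (Fin N)) (hs : p ≤ s.length) :
    eventsOp q [⟨y, r⟩, ⟨x, p⟩] g s =
      eventsOp q [⟨x, p⟩, ⟨y, r - x.bottom.length + x.top.length⟩] g s := by
  obtain ⟨r, rfl⟩ := Nat.exists_eq_add_of_le h
  have h1 : p + x.bottom.length + r - x.bottom.length + x.top.length =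
      p + (r + x.top.length) := by omega
  rw [h1, show p + x.bottom.length + r = p + (r + x.bottom.length) by omega]
  refine eventsOp_eq_of_shift q (x := fun p => [⟨y, p + (r + x.bottom.length)⟩, ⟨x, p⟩])
    (y := fun p => [⟨x, p⟩, ⟨y, p + (r + x.top.length)⟩]) (c := 0)
    (fun p => by simp; omega) (fun p => by simp; omega) (fun g s _ => ?_) p g s hs
  simpa using eventsOp_interchange_zero q x y r g s

/-- The operator of a stack of events is invariant under elementary isotopies. -/
theorem eventsOp_move (hq : q ≠ 0) {x y : List Event} (h : Move x y) {t u : List Bool}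
    (hx : Runs t x u) (g : List (Fin N) → ℝ) {s : List (Fin N)} (hs : s.length = t.length) :
    eventsOp q x g s = eventsOp q y g s := by
  -- The length condition of each local identity comes from the fact that the first events of the
  -- move can be stacked on `t`; at most five events have to be inspected.
  rcases h with ⟨x, y, p, r, h⟩ | ⟨ε, p⟩ | ⟨ε, p⟩ | ⟨σ, p⟩ | ⟨σ, p⟩ | ⟨σ, p⟩ | ⟨σ, p⟩ | ⟨σ, p⟩ |
    ⟨σ, p⟩ | ⟨p⟩ <;> obtain ⟨t₁, hx, h1, h1'⟩ := hx.cons_inv <;>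
    obtain ⟨t₂, hx, h2, h2'⟩ := hx.cons_inv <;>
    simp only [Piece.bottom, Piece.top, List.length_cons, List.length_nil] at h1 h1' h2 h2'
  · exact eventsOp_interchange q x y p r h g s (by omega)
  · exact eventsOp_zigzag_left hq ε p g s (by omega)
  · exact eventsOp_zigzag_right hq ε p g s (by omega)
  · obtain ⟨t₃, hx, h3, h3'⟩ := hx.cons_inv
    obtain ⟨t₄, hx, h4, h4'⟩ := hx.cons_inv
    obtain ⟨t₅, hx, h5, -⟩ := hx.cons_inv
    simp only [Piece.bottom, Piece.top, List.length_cons, List.length_nil] at h3 h3' h4 h4' h5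
    exact eventsOp_rotate hq σ p g s (by omega)
  · exact eventsOp_reidemeister1_right hq σ p g s (by omega)
  · exact eventsOp_reidemeister1_left hq σ p g s (by omega)
  · exact eventsOp_reidemeister2 hq σ p g s (by omega)
  · obtain ⟨t₃, hx, h3, h3'⟩ := hx.cons_inv
    simp only [Piece.bottom, Piece.top, List.length_cons, List.length_nil] at h3 h3'
    exact eventsOp_reidemeister2_up_down hq σ p g s (by omega)
  · exact eventsOp_reidemeister2_down_up hq σ p g s (by omega)
  · exact eventsOp_reidemeister3 p hq g s (by omega)

/-- The `R`-matrix state sum of a link diagram. -/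
noncomputable def stateSum (N : ℕ) (q : ℝ) (D : LinkDiagram) : ℝ :=
  eventsOp (N := N) q D.events (fun s => if s = [] then 1 else 0) []

theorem stateSum_isotopyStep (hq : q ≠ 0) {D D' : LinkDiagram} (h : D.IsotopyStep D') :
    stateSum N q D = stateSum N q D' := by
  obtain ⟨a, x, y, b, hxy, hD, hD'⟩ := h
  have hr := D.closed
  rw [hD] at hr
  obtain ⟨m, hr, -⟩ := hr.append_inv
  obtain ⟨m', ha, hx⟩ := hr.append_inv
  simp only [stateSum, hD, hD', eventsOp_append]
  set k := eventsOp q b fun s : List (Fin N) => if s = [] then (1 : ℝ) else 0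
  have := eventsOp_relation (N := N) q ha (a := 1) (b := -1) (c := 0)
    (f := eventsOp q x k) (g := eventsOp q y k) (h := k)
    (fun s hs => by rw [eventsOp_move hq hxy hx k hs]; ring) (s := []) rfl
  linarith

theorem stateSum_isotopic (hq : q ≠ 0) {D D' : LinkDiagram} (h : D.Isotopic D') :
    stateSum N q D = stateSum N q D' := by
  induction h with
  | rel _ _ h => exact stateSum_isotopyStep hq h
  | refl _ => rfl
  | symm _ _ _ ih => exact ih.symm
  | trans _ _ _ _ _ ih1 ih2 => exact ih1.trans ih2

/-- After the framing factors are removed, this is the Hecke relation $R-R^{-1}=q-q^{-1}$: the flips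
cancel, and the two diagonal coefficients differ by $q-q^{-1}$ for every order of the labels. -/
theorem eventsOp_skein (hq : q ≠ 0) (p : ℕ) (g : List (Fin N) → ℝ) (s : List (Fin N))
    (hs : p + 2 ≤ s.length) :
    q ^ N * eventsOp q [X true p] g s + -(q ^ N)⁻¹ * eventsOp q [X false p] g s +
      -(q - q⁻¹) * g s = 0 := by
  induction p generalizing g s with
  | zero =>
    obtain ⟨i, j, t, rfl⟩ := exists_cons_cons_of_two_le hs
    simp only [eventsOp, pieceOpAt, pieceOp, crossingScale, if_true, Bool.false_eq_true, if_false]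
    rcases lt_trichotomy i j with h | rfl | h
    · simp [crossingCoeff, h, h.not_gt, h.ne]
      field_simp
      ring
    · simp [crossingCoeff]
      field_simp
      ring
    · simp [crossingCoeff, h, h.not_gt, h.ne']
      field_simp
      ring
  | succ p ih =>
    rcases s with _ | ⟨h, t⟩
    · simp at hs
    · exact ih (fun s => g (h :: s)) t (by simp at hs; omega)

theorem stateSum_skein (hq : q ≠ 0) {Dp Dm D0 : LinkDiagram} (h : IsSkeinTriple Dp Dm D0) :
    q ^ N * stateSum N q Dp - (q ^ N)⁻¹ * stateSum N q Dm = (q - q⁻¹) * stateSum N q D0 := by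
  obtain ⟨a, p, b, hp, hm, h0⟩ := h
  have hr := Dp.closed
  rw [hp] at hr
  obtain ⟨m, hr, -⟩ := hr.append_inv
  obtain ⟨m', ha, hx⟩ := hr.append_inv
  obtain ⟨-, -, h1, -⟩ := hx.cons_inv
  simp only [Piece.bottom, List.length_cons, List.length_nil] at h1
  simp only [stateSum, hp, hm, h0, eventsOp_append]
  set k := eventsOp q b fun s : List (Fin N) => if s = [] then (1 : ℝ) else 0
  have := eventsOp_relation (N := N) q ha (a := q ^ N) (b := -(q ^ N)⁻¹) (c := -(q - q⁻¹))
    (f := eventsOp q [X true p] k) (g := eventsOp q [X false p] k) (h := k)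
    (fun s hs => eventsOp_skein hq p k s (by omega)) (s := []) rfl
  linarith

theorem stateSum_unknot_pos [NeZero N] (hq : 0 < q) : 0 < stateSum N q unknot := by
  simp only [stateSum, unknot, eventsOp, pieceOpAt, pieceOp, cupWeight, capWeight, if_true,
    one_mul, mul_one]
  exact Finset.sum_pos (fun i _ => zpow_pos hq _) ⟨0, Finset.mem_univ _⟩

end StateSum

/-! ### Uniqueness of the HOMFLY polynomial -/

/-- A Laurent polynomial that vanishes at infinitely many points is zero. -/
theorem laurentPolynomial_eq_zero_of_eval₂ {A K : Type*} [CommRing A] [Field K] {φ : A →+* K}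
    (hφ : Function.Injective φ) {S : Set Kˣ} (hS : S.Infinite) {P : A[T;T⁻¹]}
    (h : ∀ x ∈ S, LaurentPolynomial.eval₂ φ x P = 0) : P = 0 := by
  obtain ⟨n, f, hf⟩ := P.exists_T_pow
  have h1 : f.map φ = 0 := by
    refine Polynomial.eq_zero_of_infinite_isRoot _
      ((hS.image (f := Units.val) (Units.val_injective.injOn)).mono ?_)
    rintro _ ⟨x, hx, rfl⟩
    have h2 := congrArg (LaurentPolynomial.eval₂ φ x) hf
    rw [map_mul, h x hx, zero_mul, LaurentPolynomial.eval₂_toLaurent] at h2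
    simpa [Polynomial.IsRoot, Polynomial.eval_map] using h2
  have h2 : f = 0 := (Polynomial.map_eq_zero_iff hφ).1 h1
  rw [h2, map_zero] at hf
  exact ((LaurentPolynomial.isUnit_T n).mul_left_eq_zero).1 hf.symm

theorem eval₂_injective_of_transcendental {x : ℝˣ} (hx : Transcendental ℤ (x : ℝ)) :
    Function.Injective (LaurentPolynomial.eval₂ (Int.castRingHom ℝ) x) := by
  rw [injective_iff_map_eq_zero]
  intro P hP
  obtain ⟨n, f, hf⟩ := P.exists_T_pow
  have h2 := congrArg (LaurentPolynomial.eval₂ (Int.castRingHom ℝ) x) hf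
  rw [map_mul, hP, zero_mul, LaurentPolynomial.eval₂_toLaurent] at h2
  have h3 : f = 0 := by
    by_contra h
    exact hx ⟨f, h, by simpa [Polynomial.aeval_def] using h2⟩
  rw [h3, map_zero] at hf
  exact ((LaurentPolynomial.isUnit_T n).mul_left_eq_zero).1 hf.symm

/-- Evaluation of a Laurent polynomial in `v` and `z`. -/
noncomputable def evalVZ (v z : ℝˣ) : Laurent₂ →+* ℝ :=
  LaurentPolynomial.eval₂ (LaurentPolynomial.eval₂ (Int.castRingHom ℝ) v) z

theorem evalVZ_vPow (v z : ℝˣ) (k : ℤ) : evalVZ v z (vPow k) = (v : ℝ) ^ k := by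
  simp [evalVZ, vPow]

theorem evalVZ_zVar (v z : ℝˣ) : evalVZ v z zVar = z := by
  simp [evalVZ, zVar]

/-- The linear extension of a numerical link invariant, with the scalars evaluated. -/
noncomputable def evalDiagrams (v z : ℝˣ) (F : LinkDiagram → ℝ) :
    (LinkDiagram →₀ Laurent₂) →+ ℝ :=
  Finsupp.liftAddHom fun D => (AddMonoidHom.mulRight (F D)).comp (evalVZ v z).toAddMonoidHom

theorem evalDiagrams_single (v z : ℝˣ) (F : LinkDiagram → ℝ) (D : LinkDiagram) (P : Laurent₂) :
    evalDiagrams v z F (Finsupp.single D P) = evalVZ v z P * F D := by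
  simp [evalDiagrams]

theorem evalDiagrams_smul (v z : ℝˣ) (F : LinkDiagram → ℝ) (P : Laurent₂)
    (x : LinkDiagram →₀ Laurent₂) :
    evalDiagrams v z F (P • x) = evalVZ v z P * evalDiagrams v z F x := by
  induction x using Finsupp.induction_linear with
  | zero => simp
  | add f g hf hg => rw [smul_add, map_add, map_add, hf, hg, mul_add]
  | single D a => rw [Finsupp.smul_single, evalDiagrams_single, evalDiagrams_single, smul_eq_mul,
      map_mul, mul_assoc]

theorem diagrams_sub_eq (x y : LinkDiagram →₀ Laurent₂) : x - y = x + (-1 : Laurent₂) • y := by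
  ext1 D
  have h : ∀ a b : Laurent₂, a - b = a + (-1) * b := fun a b => by ring
  exact h (x D) (y D)

theorem evalDiagrams_sub (v z : ℝˣ) (F : LinkDiagram → ℝ) (x y : LinkDiagram →₀ Laurent₂) :
    evalDiagrams v z F (x - y) = evalDiagrams v z F x - evalDiagrams v z F y := by
  rw [diagrams_sub_eq, map_add, evalDiagrams_smul, map_neg, map_one]
  ring

/-- A numerical invariant of isotopy and skein relation vanishes on all skein relations. -/
theorem evalDiagrams_skeinRelations {v z : ℝˣ} {F : LinkDiagram → ℝ}
    (hF : ∀ D D' : LinkDiagram, D.Isotopic D' → F D = F D')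
    (hs : ∀ Dp Dm D0 : LinkDiagram, IsSkeinTriple Dp Dm D0 →
      (v : ℝ)⁻¹ * F Dp - v * F Dm = z * F D0)
    {x : LinkDiagram →₀ Laurent₂} (hx : x ∈ skeinRelations) : evalDiagrams v z F x = 0 := by
  induction hx using Submodule.span_induction with
  | mem x hx =>
    rcases hx with ⟨D, D', h, rfl⟩ | ⟨Dp, Dm, D0, h, rfl⟩
    · simp only [evalDiagrams_sub, evalDiagrams_single, map_one, one_mul]
      rw [hF D D' h, sub_self]
    · simp only [evalDiagrams_sub, evalDiagrams_single, evalVZ_vPow, evalVZ_zVar, zpow_neg_one, zpow_one]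
      rw [hs Dp Dm D0 h, sub_self]
  | zero => simp
  | add x y _ _ hx hy => rw [map_add, hx, hy, add_zero]
  | smul a x _ hx => rw [evalDiagrams_smul, hx, mul_zero]

/-- The numbers `q - q⁻¹` with `q = v ^ (-1 / N)`. -/
theorem exists_infinite_roots {v : ℝ} (hv : 0 < v) (hv1 : v ≠ 1) :
    ∃ S : Set ℝˣ, S.Infinite ∧ ∀ z ∈ S, ∃ N : ℕ, N ≠ 0 ∧ ∃ q : ℝ, 0 < q ∧
      v = (q ^ N)⁻¹ ∧ (z : ℝ) = q - q⁻¹ := by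
  -- With `N = n + 1`, so that `N` is never zero. The `Q n` are distinct because `v ≠ 1`, and
  -- $q\mapsto q-q^{-1}$ is injective on positive reals, so the resulting values of `z` are
  -- distinct.
  let Q : ℕ → ℝ := fun n => v ^ (-(1 / ((n : ℝ) + 1)))
  have hQ : ∀ n, 0 < Q n := fun n => Real.rpow_pos_of_pos hv _
  have hQN : ∀ n, v = (Q n ^ (n + 1))⁻¹ := fun n => by
    have h : (n : ℝ) + 1 ≠ 0 := by positivity
    simp only [Q]
    rw [← Real.rpow_natCast, ← Real.rpow_mul hv.le, ← Real.rpow_neg hv.le]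
    push_cast
    rw [show -(-(1 / ((n : ℝ) + 1)) * (n + 1)) = 1 by field_simp, Real.rpow_one]
  have hQinj : Function.Injective Q := fun m n h => by
    have h1 := (Real.rpow_right_inj hv hv1).1 h
    have h2 : (m : ℝ) + 1 ≠ 0 := by positivity
    have h3 : (n : ℝ) + 1 ≠ 0 := by positivity
    field_simp at h1
    have h4 : (m : ℝ) = n := by linarith
    exact_mod_cast h4
  have hQ1 : ∀ n, Q n ≠ 1 := fun n h => hv1 (by rw [hQN n, h]; simp)
  have hz : ∀ n, Q n - (Q n)⁻¹ ≠ 0 := fun n h => by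
    have h1 := hQ n
    have h2 := hQ1 n
    field_simp at h
    have : (Q n - 1) * (Q n + 1) = 0 := by linear_combination h
    rcases mul_eq_zero.1 this with h | h
    · exact h2 (by linarith)
    · linarith
  refine ⟨Set.range fun n => Units.mk0 _ (hz n), Set.infinite_range_of_injective fun m n h => ?_, ?_⟩
  · have h1 : Q m - (Q m)⁻¹ = Q n - (Q n)⁻¹ := by simpa using congrArg Units.val h
    have hm := hQ m
    have hn := hQ n
    field_simp at h1
    have h2 : (Q m - Q n) * (Q m * Q n + 1) = 0 := by linear_combination h1
    rcases mul_eq_zero.1 h2 with h | h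
    · exact hQinj (by linarith)
    · have := mul_pos hm hn
      linarith
  · rintro _ ⟨n, rfl⟩
    exact ⟨n + 1, by simp, Q n, hQ n, hQN n, rfl⟩

/-- Only the zero multiple of the unknot is a consequence of the skein relations. -/
theorem eq_zero_of_single_unknot_mem {P : Laurent₂}
    (h : Finsupp.single unknot P ∈ skeinRelations) : P = 0 := by
  -- Evaluating `v` at a transcendental number loses no information about the coefficients in
  -- $\mathbb Z[v^{\pm1}]$. What remains is a Laurent polynomial in `z` alone, to be killed by
  -- infinitely many roots.
  have htr : Transcendental ℤ (liouvilleNumber ((2 : ℕ) : ℝ)) :=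
    transcendental_liouvilleNumber le_rfl
  have h0 : 0 < liouvilleNumber ((2 : ℕ) : ℝ) :=
    (LiouvilleNumber.summable (by norm_num)).tsum_pos (fun _ => by positivity) 0 (by positivity)
  have h1 : liouvilleNumber ((2 : ℕ) : ℝ) ≠ 1 := fun h => by
    rw [h] at htr
    exact htr isAlgebraic_one
  obtain ⟨S, hS, hS'⟩ := exists_infinite_roots h0 h1
  refine laurentPolynomial_eq_zero_of_eval₂
    (eval₂_injective_of_transcendental (x := Units.mk0 _ h0.ne') htr) hS fun z hz => ?_
  obtain ⟨N, hN, q, hq, hv, hzq⟩ := hS' z hz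
  have : NeZero N := ⟨hN⟩
  have h2 := evalDiagrams_skeinRelations (v := Units.mk0 _ h0.ne') (z := z) (F := stateSum N q)
    (fun _ _ h => stateSum_isotopic hq.ne' h)
    (fun _ _ _ h => by
      have := stateSum_skein (N := N) hq.ne' h
      rw [Units.val_mk0, hv, hzq, inv_inv]
      exact this) h
  rw [evalDiagrams_single] at h2
  exact (mul_eq_zero.1 h2).resolve_right (stateSum_unknot_pos hq).ne'

theorem IsHomfly.unique {D : LinkDiagram} {P P' : Laurent₂} (h : IsHomfly D P)
    (h' : IsHomfly D P') : P = P' := by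
  rw [IsHomfly, diagrams_sub_eq] at h h'
  have h1 := skeinRelations.add_mem h (skeinRelations.smul_mem (-1) h')
  have h2 : Finsupp.single D 1 + (-1 : Laurent₂) • Finsupp.single unknot P +
      (-1 : Laurent₂) • (Finsupp.single D 1 + (-1 : Laurent₂) • Finsupp.single unknot P') =
      Finsupp.single unknot (P' - P) := by
    classical
    ext1 E
    simp only [Finsupp.add_apply, Finsupp.smul_apply, Finsupp.single_apply, smul_eq_mul]
    split_ifs <;> ring
  rw [h2] at h1
  exact (sub_eq_zero.1 (eq_zero_of_single_unknot_mem h1)).symm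

/-- Any value derived by skein moves may thus be used in place of the chosen one. -/
theorem IsHomfly.homfly_eq {D : LinkDiagram} {P : Laurent₂} (h : IsHomfly D P) : homfly D = P :=
  (Classical.epsilon_spec (p := IsHomfly D) ⟨P, h⟩ : IsHomfly D (homfly D)).unique h

/-! ### Reduction of positive words -/

/-- A property of positive words that is inherited along braid relations and along the quadratic
relation. -/
structure IsHeckeClosed (Q : List ℕ → Prop) : Prop where
  braid : ∀ a c i, Q (a ++ [i, i + 1, i] ++ c) → Q (a ++ [i + 1, i, i + 1] ++ c)
  comm : ∀ a c i j, i + 2 ≤ j → (Q (a ++ [i, j] ++ c) ↔ Q (a ++ [j, i] ++ c))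
  square : ∀ a c i, Q (a ++ c) → Q (a ++ [i] ++ c) → Q (a ++ [i, i] ++ c)

/-- Allows the reduction to be applied to a subword while its surroundings stay fixed. -/
theorem IsHeckeClosed.context {Q : List ℕ → Prop} (hQ : IsHeckeClosed Q) (l r : List ℕ) :
    IsHeckeClosed fun w => Q (l ++ w ++ r) where
  braid a c i h := by simpa using hQ.braid (l ++ a) (c ++ r) i (by simpa using h)
  comm a c i j h := by simpa using hQ.comm (l ++ a) (c ++ r) i j h
  square a c i h h' := by
    simpa using hQ.square (l ++ a) (c ++ r) i (by simpa using h) (by simpa using h')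

theorem IsHeckeClosed.comm_word {Q : List ℕ → Prop} (hQ : IsHeckeClosed Q) (l r : List ℕ) (j : ℕ)
    (b : List ℕ) (hb : ∀ x ∈ b, x + 2 ≤ j) : Q (l ++ b ++ [j] ++ r) ↔ Q (l ++ [j] ++ b ++ r) := by
  induction b generalizing l with
  | nil => simp
  | cons x b ih =>
    have h1 := ih (l ++ [x]) fun y hy => hb y (List.mem_cons_of_mem _ hy)
    have h2 := hQ.comm l (b ++ r) x j (hb x (by simp))
    simp only [List.append_assoc, List.cons_append, List.nil_append] at h1 h2 ⊢
    exact h1.trans h2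

/-- Modulo the braid and quadratic relations, the largest letter is needed at most once. -/
theorem IsHeckeClosed.of_count_le_one (m : ℕ) {Q : List ℕ → Prop} (hQ : IsHeckeClosed Q)
    (h : ∀ w, (∀ x ∈ w, x ≤ m) → w.count m ≤ 1 → Q w) (w : List ℕ) (hw : ∀ x ∈ w, x ≤ m) :
    Q w := by
  induction m generalizing Q w with
  | zero =>
    induction hn : w.count 0 using Nat.strong_induction_on generalizing w with
    | _ n ih =>
    subst hn
    rcases Nat.lt_or_ge 1 (w.count 0) with hc | hc
    · rcases w with _ | ⟨x, _ | ⟨y, w⟩⟩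
      · simp at hc
      · have := List.count_le_length (a := 0) (l := [x])
        simp only [List.length_cons, List.length_nil] at this
        omega
      · simp only [List.mem_cons, forall_eq_or_imp, nonpos_iff_eq_zero] at hw
        obtain ⟨rfl, rfl, hw⟩ := hw
        refine hQ.square [] w 0 (ih _ ?_ _ ?_ rfl) (ih _ ?_ _ ?_ rfl)
        · simp
        · simpa using hw
        · simp
        · simpa using hw
    · exact h w hw hc
  | succ m IH =>
    induction hn : w.count (m + 1) using Nat.strong_induction_on generalizing w with
    | _ n ih =>
    subst hn
    rcases Nat.lt_or_ge 1 (w.count (m + 1)) with hc | hc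
    swap
    · exact h w hw hc
    -- The word is split at its first two letters `m + 1`, as `a, m + 1, b, m + 1, c`, so that `b`
    -- uses only letters up to `m`.
    obtain ⟨a, w', rfl, ha⟩ := List.eq_append_cons_of_mem
      (List.count_pos_iff.1 (by omega : 0 < w.count (m + 1)))
    have hc' : 0 < w'.count (m + 1) := by
      simp [List.count_eq_zero.2 ha] at hc
      exact List.count_pos_iff.2 hc
    obtain ⟨b, c, rfl, hb⟩ := List.eq_append_cons_of_mem (List.count_pos_iff.1 hc')
    have hwa : ∀ x ∈ a, x ≤ m + 1 := fun x hx => hw x (by simp [hx])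
    have hwc : ∀ x ∈ c, x ≤ m + 1 := fun x hx => hw x (by simp [hx])
    have hwb : ∀ x ∈ b, x ≤ m := fun x hx => by
      have h1 : x ≤ m + 1 := hw x (by simp [hx])
      have h2 : x ≠ m + 1 := fun h => hb (h ▸ hx)
      omega
    have hcb : ∀ {l : List ℕ}, (∀ x ∈ l, x ≤ m) → l.count (m + 1) = 0 := fun {l} hl =>
      List.count_eq_zero.2 fun h => by have := hl _ h; omega
    -- By the induction on `m`, applied inside the surrounding word, the part between the two
    -- letters `m + 1` may be assumed to contain `m` at most once.
    have key : ∀ b, (∀ x ∈ b, x ≤ m) → b.count m ≤ 1 →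
        Q ((a ++ [m + 1]) ++ b ++ ([m + 1] ++ c)) := by
      intro d hd hd1
      have hca := hcb hwb
      have hc0 := List.count_eq_zero.2 ha
      -- Without `m`, every letter of `d` commutes with `m + 1`, so the two letters `m + 1` meet and
      -- the quadratic relation applies. With a single `m`, they are moved next to it, and the braid
      -- relation replaces `m + 1, m, m + 1` by `m, m + 1, m`. In both cases fewer letters `m + 1`
      -- remain.
      rcases Nat.eq_zero_or_pos (d.count m) with h0 | h0
      · have hd' : ∀ x ∈ d, x + 2 ≤ m + 1 := fun x hx => by
          have h1 := hd x hx
          have h2 : x ≠ m := fun h => List.count_eq_zero.1 h0 (h ▸ hx)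
          omega
        have h1 := (hQ.comm_word a ([m + 1] ++ c) (m + 1) d hd').1 <| by
          have h2 := hQ.square (a ++ d) c (m + 1) (ih _ ?_ _ ?_ rfl) (ih _ ?_ _ ?_ rfl)
          · simpa using h2
          · simp [hc0, hcb hd, hca]
          · simp only [List.mem_append]
            rintro x ((hx | hx) | hx)
            exacts [hwa x hx, (hd x hx).trans (Nat.le_succ _), hwc x hx]
          · simp [hc0, hcb hd, hca]
          · simp only [List.mem_append, List.mem_singleton]
            rintro x (((hx | hx) | hx) | hx)
            exacts [hwa x hx, (hd x hx).trans (Nat.le_succ _), hx.le, hwc x hx]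
        simpa using h1
      · obtain ⟨e, f, rfl, he⟩ := List.eq_append_cons_of_mem (List.count_pos_iff.1 h0)
        have hf : m ∉ f := by
          simp [List.count_eq_zero.2 he] at hd1
          exact List.count_eq_zero.1 hd1
        have hwe : ∀ x ∈ e, x ≤ m := fun x hx => hd x (by simp [hx])
        have hwf : ∀ x ∈ f, x ≤ m := fun x hx => hd x (by simp [hx])
        have he' : ∀ x ∈ e, x + 2 ≤ m + 1 := fun x hx => by
          have h1 := hwe x hx
          have h2 : x ≠ m := fun h => he (h ▸ hx)
          omega
        have hf' : ∀ x ∈ f, x + 2 ≤ m + 1 := fun x hx => by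
          have h1 := hwf x hx
          have h2 : x ≠ m := fun h => hf (h ▸ hx)
          omega
        have h1 := hQ.braid (a ++ e) (f ++ c) m (ih _ ?_ _ ?_ rfl)
        · have h2 := (hQ.comm_word a ([m, m + 1] ++ f ++ c) (m + 1) e he').1 (by simpa using h1)
          have h3 := (hQ.comm_word (a ++ [m + 1] ++ e ++ [m]) c (m + 1) f hf').2
            (by simpa using h2)
          simpa using h3
        · simp [hc0, hcb hwe, hcb hwf, hca]
        · simp only [List.mem_append, List.mem_cons, List.not_mem_nil, or_false]
          rintro x (((hx | hx) | (hx | hx | hx)) | (hx | hx))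
          exacts [hwa x hx, (hwe x hx).trans (Nat.le_succ _), by omega, by omega, by omega,
            (hwf x hx).trans (Nat.le_succ _), hwc x hx]
    simpa using IH (hQ.context (a ++ [m + 1]) ([m + 1] ++ c)) key b hwb

/-! ### Bounds for the degree in `v` -/

theorem coeff_T_mul {R : Type*} [Semiring R] (n k : ℤ) (f : R[T;T⁻¹]) :
    (LaurentPolynomial.T n * f).coeff k = f.coeff (k - n) := by
  rw [LaurentPolynomial.T, AddMonoidAlgebra.coeff_single_mul_eq_mul_coeff (k - n), one_mul]
  intro m _
  constructor <;> intro h <;> omega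

theorem coeff_C_mul {R : Type*} [Semiring R] (a : R) (k : ℤ) (f : R[T;T⁻¹]) :
    (LaurentPolynomial.C a * f).coeff k = a * f.coeff k := by
  rw [← LaurentPolynomial.single_eq_C, AddMonoidAlgebra.coeff_single_mul_eq_mul_coeff k]
  intro m _
  constructor <;> intro h <;> omega

/-- No power of `v` in `P` has an exponent larger than `d`. -/
def VDegreeLE (d : ℤ) (P : Laurent₂) : Prop := ∀ k l : ℤ, d < l → (P.coeff k).coeff l = 0

theorem VDegreeLE.mono {d d' : ℤ} {P : Laurent₂} (h : VDegreeLE d P) (hd : d ≤ d') :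
    VDegreeLE d' P := fun k l hl => h k l (by omega)

theorem VDegreeLE.add {d : ℤ} {P Q : Laurent₂} (hP : VDegreeLE d P) (hQ : VDegreeLE d Q) :
    VDegreeLE d (P + Q) := fun k l hl => by
  rw [AddMonoidAlgebra.coeff_add, Finsupp.add_apply, AddMonoidAlgebra.coeff_add,
    Finsupp.add_apply, hP k l hl, hQ k l hl, add_zero]

theorem VDegreeLE.neg {d : ℤ} {P : Laurent₂} (hP : VDegreeLE d P) :
    VDegreeLE d (-P) := fun k l hl => by
  rw [AddMonoidAlgebra.coeff_neg, Finsupp.neg_apply, AddMonoidAlgebra.coeff_neg,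
    Finsupp.neg_apply, hP k l hl, neg_zero]

theorem VDegreeLE.vPow_mul {d : ℤ} {P : Laurent₂} (hP : VDegreeLE d P) (j : ℤ) :
    VDegreeLE (j + d) (vPow j * P) := fun k l hl => by
  rw [vPow, coeff_C_mul, coeff_T_mul]
  exact hP k _ (by omega)

theorem VDegreeLE.T_mul {d : ℤ} {P : Laurent₂} (hP : VDegreeLE d P) (j : ℤ) :
    VDegreeLE d (LaurentPolynomial.T j * P) := fun k l hl => by
  rw [coeff_T_mul]
  exact hP _ l hl

theorem VDegreeLE.one : VDegreeLE 0 1 := fun k l hl => by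
  rw [← LaurentPolynomial.T_zero, LaurentPolynomial.T_apply]
  split_ifs
  · rw [← LaurentPolynomial.T_zero, LaurentPolynomial.T_apply, if_neg (by omega)]
  · rfl

/-! ### Values forced by the skein relations -/

theorem vPow_add (j k : ℤ) : vPow (j + k) = vPow j * vPow k := by
  rw [vPow, LaurentPolynomial.T_add, map_mul, vPow, vPow]

theorem vPow_zero : vPow 0 = 1 := by
  rw [vPow, LaurentPolynomial.T_zero, map_one]

theorem T_neg_one_mul_zVar : (LaurentPolynomial.T (-1) : Laurent₂) * zVar = 1 := by
  rw [zVar, ← LaurentPolynomial.T_add, neg_add_cancel, LaurentPolynomial.T_zero]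

theorem isHomfly_unknot : IsHomfly unknot 1 := by
  rw [IsHomfly, diagrams_sub_eq]
  convert skeinRelations.zero_mem
  classical
  ext1 E
  simp only [Finsupp.add_apply, Finsupp.smul_apply, smul_eq_mul]
  change _ = (0 : Laurent₂)
  ring

theorem sub_mem_skeinRelations_of_isotopic {D D' : LinkDiagram} (h : D.Isotopic D') :
    Finsupp.single D (1 : Laurent₂) + (-1 : Laurent₂) • Finsupp.single D' 1 ∈ skeinRelations := by
  rw [← diagrams_sub_eq]
  exact Submodule.subset_span (Or.inl ⟨D, D', h, rfl⟩)

theorem mem_skeinRelations_of_isSkeinTriple {Dp Dm D0 : LinkDiagram} (h : IsSkeinTriple Dp Dm D0) :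
    Finsupp.single Dp (vPow (-1)) + (-1 : Laurent₂) • Finsupp.single Dm (vPow 1) +
      (-1 : Laurent₂) • Finsupp.single D0 zVar ∈ skeinRelations := by
  rw [← diagrams_sub_eq, ← diagrams_sub_eq]
  exact Submodule.subset_span (Or.inr ⟨Dp, Dm, D0, h, rfl⟩)

theorem IsHomfly.of_isotopic {D D' : LinkDiagram} {P : Laurent₂} (h : D.Isotopic D')
    (hP : IsHomfly D' P) : IsHomfly D P := by
  rw [IsHomfly, diagrams_sub_eq] at hP ⊢
  convert skeinRelations.add_mem (sub_mem_skeinRelations_of_isotopic h) hP using 1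
  ext1 E
  simp only [Finsupp.add_apply, Finsupp.smul_apply, smul_eq_mul]
  ring

theorem single_apply_eq_mul (D E : LinkDiagram) (P : Laurent₂) :
    Finsupp.single D P E = P * Finsupp.single D (1 : Laurent₂) E := by
  classical
  rw [Finsupp.single_apply, Finsupp.single_apply]
  split_ifs <;> ring

theorem IsHomfly.of_skein {Dp Dm D0 : LinkDiagram} {Pm P0 : Laurent₂}
    (h : IsSkeinTriple Dp Dm D0) (hm : IsHomfly Dm Pm) (h0 : IsHomfly D0 P0) :
    IsHomfly Dp (vPow 2 * Pm + vPow 1 * (zVar * P0)) := by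
  rw [IsHomfly, diagrams_sub_eq] at hm h0 ⊢
  have h1 := skeinRelations.add_mem (skeinRelations.add_mem
    (skeinRelations.smul_mem (vPow 1) (mem_skeinRelations_of_isSkeinTriple h))
    (skeinRelations.smul_mem (vPow 2) hm)) (skeinRelations.smul_mem (vPow 1 * zVar) h0)
  convert h1 using 1
  have e1 : vPow 1 * vPow (-1) = 1 := by rw [← vPow_add, ← vPow_zero]; rfl
  have e2 : vPow 2 = vPow 1 * vPow 1 := by rw [← vPow_add]; rfl
  ext1 E
  simp only [Finsupp.add_apply, Finsupp.smul_apply, smul_eq_mul, e2]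
  rw [single_apply_eq_mul Dp E (vPow (-1)), single_apply_eq_mul Dm E (vPow 1),
    single_apply_eq_mul D0 E zVar, single_apply_eq_mul unknot E (_ + _), single_apply_eq_mul unknot E Pm, single_apply_eq_mul unknot E P0]
  linear_combination -Finsupp.single Dp (1 : Laurent₂) E * e1

/-- The skein relation solved for $L_0$, which is possible because `z` is a unit. It is meant for
kinks, where both signs of the crossing give the same link. -/
theorem IsHomfly.smoothing {Dp Dm D0 : LinkDiagram} {P : Laurent₂}
    (h : IsSkeinTriple Dp Dm D0) (hp : IsHomfly Dp P) (hm : IsHomfly Dm P) :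
    IsHomfly D0 (LaurentPolynomial.T (-1) * (vPow (-1) * P + -(vPow 1 * P))) := by
  rw [IsHomfly, diagrams_sub_eq] at hp hm ⊢
  have h1 := skeinRelations.add_mem (skeinRelations.add_mem
    (skeinRelations.smul_mem (-LaurentPolynomial.T (-1)) (mem_skeinRelations_of_isSkeinTriple h))
    (skeinRelations.smul_mem (-LaurentPolynomial.T (-1) * vPow 1) hm))
    (skeinRelations.smul_mem (LaurentPolynomial.T (-1) * vPow (-1)) hp)
  convert h1 using 1
  have e1 := T_neg_one_mul_zVar
  ext1 E
  simp only [Finsupp.add_apply, Finsupp.smul_apply, smul_eq_mul]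
  rw [single_apply_eq_mul Dp E (vPow (-1)), single_apply_eq_mul Dm E (vPow 1),
    single_apply_eq_mul D0 E zVar, single_apply_eq_mul unknot E P,
    single_apply_eq_mul unknot E (_ * _)]
  linear_combination -Finsupp.single D0 (1 : Laurent₂) E * e1

/-- The stack of events `w` is a link diagram whose HOMFLY polynomial exists and has exponents of
`v` at most `d`. -/
def HasVDegreeLE (d : ℤ) (w : List Event) : Prop :=
  ∃ (h : Runs [] w []) (P : Laurent₂), VDegreeLE d P ∧ IsHomfly ⟨w, h⟩ P

theorem HasVDegreeLE.mono {d d' : ℤ} {w : List Event} (h : HasVDegreeLE d w) (hd : d ≤ d') :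
    HasVDegreeLE d' w := by
  obtain ⟨h, P, hP, hD⟩ := h
  exact ⟨h, P, hP.mono hd, hD⟩

theorem HasVDegreeLE.of_move {d : ℤ} {x y a b : List Event} (hxy : Move x y)
    (hr : Runs [] (a ++ x ++ b) []) (h : HasVDegreeLE d (a ++ y ++ b)) :
    HasVDegreeLE d (a ++ x ++ b) := by
  obtain ⟨h, P, hP, hD⟩ := h
  exact ⟨hr, P, hP, hD.of_isotopic (.rel _ _ ⟨a, x, y, b, hxy, rfl, rfl⟩)⟩

theorem HasVDegreeLE.of_move_symm {d : ℤ} {x y a b : List Event} (hxy : Move x y)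
    (hr : Runs [] (a ++ y ++ b) []) (h : HasVDegreeLE d (a ++ x ++ b)) :
    HasVDegreeLE d (a ++ y ++ b) := by
  obtain ⟨h, P, hP, hD⟩ := h
  exact ⟨hr, P, hP, hD.of_isotopic (.symm _ _ (.rel _ _ ⟨a, x, y, b, hxy, rfl, rfl⟩))⟩

theorem Runs.crossing_cons {s : Bool} {p : ℕ} {t u : List Bool} {w : List Event}
    (h : Runs t (X s p :: w) u) (s' : Bool) : Runs t (X s' p :: X s p :: w) u := by
  cases h with
  | cons a b x w t h => exact Runs.cons a b (.crossing s') _ _ (Runs.cons a b (.crossing s) _ _ h)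

/-- The skein relation at the lower crossing: switching it gives a pair that cancels by the second
Reidemeister move, and smoothing it leaves one crossing. The shifts by `2` and `1` are the exponents
in $P_+=v^2P_-+vz\,P_0$. -/
theorem HasVDegreeLE.square {d : ℤ} {a b : List Event} {p : ℕ} (h : HasVDegreeLE (d - 2) (a ++ b))
    (h' : HasVDegreeLE (d - 1) (a ++ [X true p] ++ b)) :
    HasVDegreeLE d (a ++ [X true p, X true p] ++ b) := by
  obtain ⟨hr, P, hP, hD⟩ := h'
  rw [List.append_assoc] at hr
  obtain ⟨m, ha, hb⟩ := hr.append_inv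
  have hr2 (s : Bool) : Runs [] (a ++ [X s p, X true p] ++ b) [] := by
    rw [List.append_assoc]
    exact ha.append (hb.crossing_cons s)
  obtain ⟨hr', P', hP', hD'⟩ : HasVDegreeLE (d - 2) (a ++ [X false p, X true p] ++ b) :=
    HasVDegreeLE.of_move (.reidemeister2 false p) (hr2 false) (by simpa using h)
  refine ⟨hr2 true, _, ?_, IsHomfly.of_skein ⟨a, p, X true p :: b, ?_, ?_, ?_⟩ hD' hD⟩
  · exact ((hP'.vPow_mul 2).mono (by omega)).add (((hP.T_mul 1).vPow_mul 1).mono (by omega))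
  · simp
  · simp
  · simp

/-- A circle beside an upward strand is the smoothing of a kink in that strand, and kinks of both
signs can be undone. Hence the circle multiplies the polynomial by $(v^{-1}-v)z^{-1}$. -/
theorem HasVDegreeLE.circle {d : ℤ} {a b : List Event} {p : ℕ}
    (h : HasVDegreeLE (d - 1) (a ++ b)) {l r : List Bool} (hl : l.length = p)
    (ha : Runs [] a (l ++ true :: r)) (hb : Runs (l ++ true :: r) b []) :
    HasVDegreeLE d (a ++ [cup true (p + 1), cap true (p + 1)] ++ b) := by
  subst hl
  have hcap : Runs (l ++ [true, true, false] ++ r) (cap true (l.length + 1) :: b) [] := by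
    simpa [Piece.bottom] using Runs.cons (l ++ [true]) r (.cap true) b [] (by simpa [Piece.top])
  have hX (s : Bool) : Runs (l ++ [true, true, false] ++ r)
      (X s l.length :: cap true (l.length + 1) :: b) [] := by
    simpa [Piece.bottom] using Runs.cons l (false :: r) (.crossing s) _ []
      (by simpa [Piece.top] using hcap)
  have hcup {w : List Event} (hw : Runs (l ++ [true, true, false] ++ r) w []) :
      Runs [] (a ++ cup true (l.length + 1) :: w) [] := by
    refine ha.append ?_
    simpa [Piece.bottom] using Runs.cons (l ++ [true]) r (.cup true) w []
      (by simpa [Piece.top] using hw)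
  obtain ⟨hr, P, hP, hD⟩ := h
  have hk (s : Bool) : IsHomfly ⟨_, hcup (hX s)⟩ P :=
    hD.of_isotopic (.rel _ _ ⟨a, _, _, b, .reidemeister1_right s l.length, by simp, by simp⟩)
  have hr0 : Runs [] (a ++ [cup true (l.length + 1), cap true (l.length + 1)] ++ b) [] := by
    simpa using hcup hcap
  refine ⟨hr0, _, ?_, IsHomfly.smoothing
    ⟨a ++ [cup true (l.length + 1)], l.length, cap true (l.length + 1) :: b, ?_, ?_, ?_⟩
    (hk true) (hk false)⟩
  · exact (((hP.vPow_mul (-1)).mono (by omega)).add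
      ((hP.vPow_mul 1).mono (by omega)).neg).T_mul (-1)
  all_goals simp

/-! ### Closures of positive words -/

/-- The row of strands next to a braid on `n` strands that is going to be closed. -/
abbrev closureRow (n : ℕ) : List Bool := List.replicate n true ++ List.replicate n false

/-- The crossings of a positive word. -/
def wordEvents (w : List ℕ) : List Event := w.map (X true)

/-- The closure of a positive word on `n` strands. -/
def wordClosure (n : ℕ) (w : List ℕ) : List Event :=
  (List.range n).map (cup true) ++ wordEvents w ++ (List.range n).reverse.map (cap true)

theorem runs_wordEvents {n : ℕ} (w : List ℕ) (hw : ∀ x ∈ w, x + 2 ≤ n) (b : List Bool) :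
    Runs (List.replicate n true ++ b) (wordEvents w) (List.replicate n true ++ b) := by
  have h := runs_braid n (w.attach.map fun x => (⟨x.1, by have := hw x.1 x.2; omega⟩, true)) b
  simpa [wordEvents, List.map_map, Function.comp_def] using h

theorem runs_cup_closureRow (n : ℕ) : Runs (closureRow n) [cup true n] (closureRow (n + 1)) := by
  have h := Runs.cons (List.replicate n true) (List.replicate n false) (.cup true) [] _ (Runs.nil _)
  have e : closureRow (n + 1) =
      List.replicate n true ++ [true, false] ++ List.replicate n false := by
    rw [closureRow, List.replicate_succ' (n := n) (a := true), List.replicate_succ]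
    simp
  rw [e]
  simpa [Piece.bottom, Piece.top] using h

theorem runs_cap_closureRow (n : ℕ) : Runs (closureRow (n + 1)) [cap true n] (closureRow n) := by
  have h := Runs.cons (List.replicate n true) (List.replicate n false) (.cap true) [] _
    (by simpa [Piece.top] using Runs.nil _)
  have e : closureRow (n + 1) =
      List.replicate n true ++ [true, false] ++ List.replicate n false := by
    rw [closureRow, List.replicate_succ' (n := n) (a := true), List.replicate_succ]
    simp
  rw [e]
  simpa [Piece.bottom] using h

theorem runs_wordClosure {n : ℕ} (w : List ℕ) (hw : ∀ x ∈ w, x + 2 ≤ n) :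
    Runs [] (wordClosure n w) [] :=
  ((runs_cups n).append (runs_wordEvents w hw _)).append (runs_caps n)

/-- A local minimum is moved down below distant crossings. -/
theorem HasVDegreeLE.cup_below {d : ℤ} {n : ℕ} {l r : List Event} (hl : Runs [] l (closureRow n))
    (hr : Runs (closureRow (n + 1)) r []) (w : List ℕ) (hw : ∀ x ∈ w, x + 2 ≤ n)
    (h : HasVDegreeLE d (l ++ wordEvents w ++ [cup true n] ++ r)) :
    HasVDegreeLE d (l ++ [cup true n] ++ wordEvents w ++ r) := by
  induction w generalizing l with
  | nil => simpa [wordEvents] using h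
  | cons x w ih =>
    have hx := hw x (by simp)
    have hw' : ∀ y ∈ w, y + 2 ≤ n := fun y hy => hw y (by simp [hy])
    have h1 := ih (l := l ++ [X true x])
      (hl.append (runs_wordEvents [x] (by simpa using hx) _)) hw' (by simpa [wordEvents] using h)
    have hm := Move.interchange (.crossing true) (.cup true) x n hx
    rw [show n - (Piece.crossing true).bottom.length + (Piece.crossing true).top.length = n by
      simp only [Piece.bottom, Piece.top, List.length_cons, List.length_nil]; omega] at hm
    have h2 := HasVDegreeLE.of_move (a := l) (b := wordEvents w ++ r) (d := d) hm ?_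
      (by simpa using h1)
    · simpa [wordEvents] using h2
    · have h3 := ((hl.append (runs_cup_closureRow n)).append
        (runs_wordEvents (n := n + 1) (x :: w) (fun y hy => (hw y hy).trans (Nat.le_succ _)) _)).append
          hr
      simpa [wordEvents] using h3

/-- A local maximum is moved up above distant crossings. -/
theorem HasVDegreeLE.cap_above {d : ℤ} {n : ℕ} {l r : List Event}
    (hl : Runs [] l (closureRow (n + 1)))
    (hr : Runs (closureRow n) r []) (w : List ℕ) (hw : ∀ x ∈ w, x + 2 ≤ n)
    (h : HasVDegreeLE d (l ++ [cap true n] ++ wordEvents w ++ r)) :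
    HasVDegreeLE d (l ++ wordEvents w ++ [cap true n] ++ r) := by
  induction w generalizing l with
  | nil => simpa [wordEvents] using h
  | cons x w ih =>
    have hx := hw x (by simp)
    have hw' : ∀ y ∈ w, y + 2 ≤ n := fun y hy => hw y (by simp [hy])
    have hlx : Runs [] (l ++ [X true x]) (closureRow (n + 1)) :=
      hl.append (runs_wordEvents [x] (by simp; omega) _)
    have hm := Move.interchange (.crossing true) (.cap true) x n hx
    rw [show n - (Piece.crossing true).bottom.length + (Piece.crossing true).top.length = n by
      simp only [Piece.bottom, Piece.top, List.length_cons, List.length_nil]; omega] at hm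
    have h2 := HasVDegreeLE.of_move_symm (a := l) (b := wordEvents w ++ r) (d := d) hm ?_
      (by simpa [wordEvents] using h)
    · simpa [wordEvents] using ih hlx hw' (by simpa using h2)
    · have h3 := ((hlx.append (runs_cap_closureRow n)).append
        (runs_wordEvents (n := n) w hw' _)).append hr
      simpa using h3

/-- Braid relations are isotopies and preserve the length. For the quadratic relation, the shorter
words have length smaller by two and by one, exactly the drops that `HasVDegreeLE.square` demands.
The range of the letters is part of the property, since closure is required over all words. -/
theorem isHeckeClosed_wordClosure (n : ℕ) : IsHeckeClosed fun w =>
    (∀ x ∈ w, x + 2 ≤ n) → HasVDegreeLE (n + w.length - 1) (wordClosure n w) where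
  braid a c i h hw := by
    have h1 := h (by simp at hw ⊢; grind)
    have h2 := HasVDegreeLE.of_move_symm (Move.reidemeister3 i)
      (a := (List.range n).map (cup true) ++ wordEvents a)
      (b := wordEvents c ++ (List.range n).reverse.map (cap true))
      (by simpa [wordClosure, wordEvents] using runs_wordClosure _ hw)
      (by simpa [wordClosure, wordEvents] using h1)
    simpa [wordClosure, wordEvents] using h2
  comm a c i j hij := by
    have hm := Move.interchange (.crossing true) (.crossing true) i j hij
    rw [show j - (Piece.crossing true).bottom.length + (Piece.crossing true).top.length = j by
      simp only [Piece.bottom, Piece.top, List.length_cons, List.length_nil]; omega] at hm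
    constructor
    · intro h hw
      have h1 := h (by simp at hw ⊢; grind)
      have h2 := HasVDegreeLE.of_move hm
        (a := (List.range n).map (cup true) ++ wordEvents a)
        (b := wordEvents c ++ (List.range n).reverse.map (cap true))
        (by simpa [wordClosure, wordEvents] using runs_wordClosure _ hw)
        (by simpa [wordClosure, wordEvents] using h1)
      simpa [wordClosure, wordEvents] using h2
    · intro h hw
      have h1 := h (by simp at hw ⊢; grind)
      have h2 := HasVDegreeLE.of_move_symm hm
        (a := (List.range n).map (cup true) ++ wordEvents a)
        (b := wordEvents c ++ (List.range n).reverse.map (cap true))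
        (by simpa [wordClosure, wordEvents] using runs_wordClosure _ hw)
        (by simpa [wordClosure, wordEvents] using h1)
      simpa [wordClosure, wordEvents] using h2
  square a c i h h' hw := by
    have h1 := h (by simp at hw ⊢; grind)
    have h1' := h' (by simp at hw ⊢; grind)
    have h2 := HasVDegreeLE.square (p := i) (d := n + (a ++ [i, i] ++ c).length - 1)
      (a := (List.range n).map (cup true) ++ wordEvents a)
      (b := wordEvents c ++ (List.range n).reverse.map (cap true))
      (by
        refine HasVDegreeLE.mono (by simpa [wordClosure, wordEvents] using h1) ?_
        simp; omega)
      (by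
        refine HasVDegreeLE.mono (by simpa [wordClosure, wordEvents] using h1') ?_
        simp)
    simpa [wordClosure, wordEvents] using h2

/-- The upper Morton–Franks–Williams bound for closures of positive words. -/
theorem hasVDegreeLE_wordClosure (n : ℕ) (w : List ℕ) (hw : ∀ x ∈ w, x + 2 ≤ n + 1) :
    HasVDegreeLE (n + w.length) (wordClosure (n + 1) w) := by
  induction n generalizing w with
  | zero =>
    obtain rfl : w = [] := List.eq_nil_iff_forall_not_mem.2 fun x hx => by
      have := hw x hx; omega
    exact ⟨unknot.closed, 1, by simpa using VDegreeLE.one, isHomfly_unknot⟩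
  | succ n ih =>
    have hcups : (List.range (n + 1 + 1)).map (cup true) =
        (List.range (n + 1)).map (cup true) ++ [cup true (n + 1)] := by
      rw [List.range_succ, List.map_append]; rfl
    have hcaps : (List.range (n + 1 + 1)).reverse.map (cap true) =
        [cap true (n + 1)] ++ (List.range (n + 1)).reverse.map (cap true) := by
      rw [List.range_succ, List.reverse_append, List.map_append]; rfl
    have hcc := runs_cups (n + 1)
    have hcp := runs_caps (n + 1)
    have hcap2 := (runs_cap_closureRow (n + 1)).append hcp
    -- On `n + 2` strands the largest letter is `n`; it remains to treat words that contain it at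
    -- most once.
    have key := (isHeckeClosed_wordClosure (n + 2)).of_count_le_one n (fun w hw hc hw' => ?_) w
      (fun x hx => by have := hw x hx; omega) hw
    · refine key.mono ?_
      push_cast; omega
    rcases Nat.eq_zero_or_pos (w.count n) with h0 | h0
    -- No crossing involves the last strand. Its minimum slides up to its maximum, and the resulting
    -- circle costs exactly the one degree allowed for the extra strand.
    · have hwn : ∀ x ∈ w, x + 2 ≤ n + 1 := fun x hx => by
        have h1 := hw x hx
        have h2 : x ≠ n := fun h => List.count_eq_zero.1 h0 (h ▸ hx)
        omega
      have h1 := HasVDegreeLE.cup_below hcc hcap2 w hwn (d := ↑(n + 2) + w.length - 1) ?_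
      · rw [wordClosure, hcups, hcaps]
        simpa using h1
      · have h2 := HasVDegreeLE.circle (d := ↑(n + 2) + w.length - 1) (p := n)
          (a := (List.range (n + 1)).map (cup true) ++ wordEvents w)
          (b := (List.range (n + 1)).reverse.map (cap true)) (l := List.replicate n true)
          (r := List.replicate (n + 1) false)
          ((ih w hwn).mono (by push_cast; omega)) (by simp) ?_ ?_
        · simpa using h2
        · simpa [closureRow, List.replicate_succ'] using hcc.append (runs_wordEvents w hwn _)
        · simpa [closureRow, List.replicate_succ'] using hcp
    -- Markov destabilization: the minimum of the last strand slides up past `a` and its maximum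
    -- down past `c`, until they form a kink with the single letter `n`. Removing the kink leaves
    -- the closure of `a ++ c` on `n + 1` strands, whose bound is smaller by two than needed.
    · obtain ⟨a, c, rfl, ha⟩ := List.eq_append_cons_of_mem (List.count_pos_iff.1 h0)
      have hc' : n ∉ c := by
        simp [List.count_eq_zero.2 ha] at hc
        exact List.count_eq_zero.1 hc
      have hwa : ∀ x ∈ a, x + 2 ≤ n + 1 := fun x hx => by
        have h1 := hw x (by simp [hx])
        have h2 : x ≠ n := fun h => ha (h ▸ hx)
        omega
      have hwc : ∀ x ∈ c, x + 2 ≤ n + 1 := fun x hx => by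
        have h1 := hw x (by simp [hx])
        have h2 : x ≠ n := fun h => hc' (h ▸ hx)
        omega
      have hX : Runs (closureRow (n + 2)) [X true n] (closureRow (n + 2)) :=
        runs_wordEvents [n] (by simp) _
      have hac := ih (a ++ c) fun x hx => (List.mem_append.1 hx).elim (hwa x) (hwc x)
      have hra := hcc.append (runs_wordEvents a hwa (List.replicate (n + 1) false))
      have hrc := runs_wordEvents c hwc (List.replicate (n + 1) false)
      have h1 := HasVDegreeLE.of_move (.reidemeister1_right true n)
        (a := (List.range (n + 1)).map (cup true) ++ wordEvents a)
        (b := wordEvents c ++ (List.range (n + 1)).reverse.map (cap true))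
        (by
          have := ((((hra.append (runs_cup_closureRow (n + 1))).append hX).append
            (runs_cap_closureRow (n + 1))).append hrc).append hcp
          simpa using this)
        (d := ↑(n + 2) + (a ++ n :: c).length - 1)
        (by
          refine HasVDegreeLE.mono (by simpa [wordClosure, wordEvents] using hac) ?_
          simp; omega)
      have h2 := HasVDegreeLE.cap_above (n := n + 1)
        (l := (List.range (n + 1)).map (cup true) ++ wordEvents a ++ [cup true (n + 1), X true n])
        (by simpa using (hra.append (runs_cup_closureRow (n + 1))).append hX) hcp c hwc
        (by simpa using h1)
      have h3 := HasVDegreeLE.cup_below hcc (r := [X true n] ++ wordEvents c ++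
          [cap true (n + 1)] ++ (List.range (n + 1)).reverse.map (cap true)) (by
          have := ((hX.append (runs_wordEvents (n := n + 2) c
            (fun y hy => (hwc y hy).trans (Nat.le_succ _)) _)).append
            (runs_cap_closureRow (n + 1))).append hcp
          simpa using this) a hwa (by simpa using h2)
      rw [wordClosure, hcups, hcaps]
      simpa [wordEvents] using h3

theorem closureEvents_of_isPositive {n : ℕ} {β : BraidWord n} (hβ : β.IsPositive) :
    closureEvents n β = wordClosure n (β.map fun x => (x.1 : ℕ)) := by
  rw [closureEvents, wordClosure, wordEvents, List.map_map]
  congr 2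
  exact List.map_congr_left fun x hx => by rw [hβ x hx]; rfl

/-- Every exponent of `v` in the HOMFLY polynomial of the closure of a positive braid is at most
the number of strands plus the number of crossings minus one. -/
theorem vDegreeLE_homfly_braidClosure {n : ℕ} (hn : 1 ≤ n) {β : BraidWord n} (hβ : β.IsPositive) :
    VDegreeLE (n + β.length - 1) (homfly (braidClosure β)) := by
  obtain ⟨n, rfl⟩ := Nat.exists_eq_add_of_le' hn
  obtain ⟨h, P, hP, hD⟩ := hasVDegreeLE_wordClosure n (β.map fun x => (x.1 : ℕ)) fun x hx => by
    obtain ⟨y, -, rfl⟩ := List.mem_map.1 hx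
    have := y.1.isLt
    omega
  have e : braidClosure β = ⟨_, h⟩ := by
    simp only [braidClosure, closureEvents_of_isPositive hβ]
  rw [e, hD.homfly_eq]
  refine hP.mono ?_
  simp

end Homflypt

theorem lemma2p3 (n : ℕ) (hn : 1 ≤ n) (β : Homflypt.BraidWord n) (hβ : β.IsPositive) :
    (Homflypt.coeffPoly 0 (Homflypt.braidClosure β)).degree ≤
      (((n : ℤ) + (β.length : ℤ) - ((Homflypt.braidClosure β).numComponents : ℤ) : ℤ) :
        WithBot ℤ) := by
  refine Finset.max_le fun l hl => WithBot.coe_le_coe.2 ?_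
  by_contra! hlt
  refine Finsupp.mem_support_iff.1 hl ?_
  -- The prefactor shifts the exponent: `l > n + e - #L` becomes `l - (1 - #L) > n + e - 1`, which
  -- is beyond the bound for the whole polynomial.
  rw [Homflypt.coeffPoly, Homflypt.coeff_T_mul]
  exact Homflypt.vDegreeLE_homfly_braidClosure hn hβ _ _ (by omega)
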